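/- All vector spaces are real. A curve $c\colon\mathbb R\to E$ in a topological vector space $E$ is smooth if all its iterated derivatives (limits of difference quotients) exist. A convenient vector space is a Hausdorff locally convex topological vector space $E$ in which every smooth curve has a smooth antiderivative. A map defined on an open subset of such a space is smooth if it maps smooth curves to smooth curves. Let $M$ be a manifold modelled on a convenient vector space $E$, that is, a topological space with an atlas of homeomorphisms from open subsets of $M$ onto open subsets of $E$ whose changes of charts are smooth (this includes Banach, Fréchet and finite-dimensional manifolds). Let $TM$ be its kinematic tangent bundle (velocities of smooth curves), and let $\eta\in\Omega^1(M)$ be a smooth 1-form, i.e. a smooth function $TM\to\mathbb R$ that is linear on each fibre. Let $d\eta$ be its exterior derivative, given in a chart by $d\eta_p(u,w)=D_u(\eta(w))(p)-D_w(\eta(u))(p)$ for $u,w\in E$ viewed as constant vector fields. For $x\in M$ put \[ \mathcal H_x=\ker\eta_x=\{v\in T_xM : \eta_x(v)=0\},\qquad \mathcal V_x=\ker d\eta_x=\{v\in T_xM : d\eta_x(v,w)=0\ \text{ for all } w\in T_xM\}. \] Then $\mathcal H\cap\mathcal V$ is an involutive distribution: for every $x\in M$ the set $\mathcal H_x\cap\mathcal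 V_x$ is a linear subspace of $T_xM$ (whose dimension may depend on $x$), and for every open $W\subseteq M$ and all smooth vector fields $X,Y$ on $W$ with $X_x,Y_x\in\mathcal H_x\cap\mathcal V_x$ for all $x\in W$, one has $[X,Y]_x\in\mathcal H_x\cap\mathcal V_x$ for all $x\in W$. -/

import Mathlib

open Filter Topology Set

noncomputable section

namespace Convenient

/-! ### Smooth curves, convenient vector spaces and smooth maps -/

section Calculus

variable {E : Type*} [AddCommGroup E] [Module ℝ E] [TopologicalSpace E]
variable {F : Type*} [AddCommGroup F] [Module ℝ F] [TopologicalSpace F]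

/-- The curve `c` is differentiable at `t`, with derivative `v = lim_{δ → 0} (c (t + δ) - c t) / δ`. -/
def HasCurveDerivAt (c : ℝ → F) (v : F) (t : ℝ) : Prop :=
  Tendsto (fun δ : ℝ => δ⁻¹ • (c (t + δ) - c t)) (𝓝[≠] 0) (𝓝 v)

/-- The derivative of the curve `c` at `t` (only meaningful where `c` is differentiable). -/
def curveDeriv (c : ℝ → F) (t : ℝ) : F :=
  limUnder (𝓝[≠] (0 : ℝ)) (fun δ : ℝ => δ⁻¹ • (c (t + δ) - c t))

/-- A smooth curve: all iterated derivatives `d 0 = c, d 1 = c', d 2 = c'', …` exist.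
They are then automatically continuous, each of them being differentiable. -/
def IsSmoothCurve (c : ℝ → F) : Prop :=
  ∃ d : ℕ → ℝ → F, d 0 = c ∧ ∀ n t, HasCurveDerivAt (d n) (d (n + 1) t) t

/-- The map `f` is smooth on the (open) set `U`: it maps smooth curves in `U` to smooth curves. -/
def IsSmoothOn (f : E → F) (U : Set E) : Prop :=
  ∀ c : ℝ → E, IsSmoothCurve c → (∀ t, c t ∈ U) → IsSmoothCurve (fun t => f (c t))

/-- The derivative of `f` at `p` in the direction `v`. -/
def dirDeriv (f : E → F) (p v : E) : F :=
  curveDeriv (fun t : ℝ => f (p + t • v)) 0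

/-- A convenient vector space: a Hausdorff locally convex topological vector space
in which every smooth curve has a smooth antiderivative. -/
class ConvenientSpace (E : Type*) [AddCommGroup E] [Module ℝ E] [TopologicalSpace E] : Prop
    extends IsTopologicalAddGroup E, ContinuousSMul ℝ E, LocallyConvexSpace ℝ E, T2Space E where
  exists_antideriv : ∀ c : ℝ → E, IsSmoothCurve c →
    ∃ C : ℝ → E, IsSmoothCurve C ∧ ∀ t, HasCurveDerivAt C (c t) t

end Calculus

/-! ### Manifolds, tangent vectors, vector fields and 1-forms -/

/-- `M`, with its atlas of charts onto open subsets of `E`, is a smooth manifold modelled on `E`: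
all changes of charts are smooth. -/
class SmoothManifold (E : Type*) [AddCommGroup E] [Module ℝ E] [TopologicalSpace E]
    (M : Type*) [TopologicalSpace M] [ChartedSpace E M] : Prop where
  smooth_transition : ∀ e ∈ atlas E M, ∀ e' ∈ atlas E M,
    IsSmoothOn (fun p => e' (e.symm p)) (e.target ∩ e.symm ⁻¹' e'.source)

section Manifold

variable (E : Type*) [AddCommGroup E] [Module ℝ E] [TopologicalSpace E]
variable {M : Type*} [TopologicalSpace M] [ChartedSpace E M]

/-- The (kinematic) tangent space of `M` at `x`. A tangent vector, that is, the class of a smooth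
curve `c` through `x = c 0`, is represented by `(φ ∘ c)' 0`, where `φ = chartAt E x` is the
preferred chart at `x`; the linear structure is that of `E`. This is the convention of Mathlib's
`TangentSpace`, which is only available over normed spaces. -/
@[nolint unusedArguments]
def TangentAt (_x : M) : Type _ := E

instance (x : M) : AddCommGroup (TangentAt E x) := inferInstanceAs (AddCommGroup E)

instance (x : M) : Module ℝ (TangentAt E x) := inferInstanceAs (Module ℝ E)

variable {E}

/-- The representative in the chart `e` of the tangent vector `v` at `x ∈ e.source`: its image under
the derivative at `x` of the change from the preferred chart at `x` to the chart `e`. -/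
def toChart (e : OpenPartialHomeomorph M E) (x : M) (v : TangentAt E x) : E :=
  dirDeriv (fun p : E => e ((chartAt E x).symm p)) (chartAt E x x) v

/-- The tangent vector at `x ∈ e.source` that is represented by `u` in the chart `e`. -/
def ofChart (e : OpenPartialHomeomorph M E) (x : M) (u : E) : TangentAt E x :=
  dirDeriv (F := E) (fun p : E => chartAt E x (e.symm p)) (e x) u

/-- The representative in the chart `e` of a vector field `X`, as an `E`-valued function on
`e.target`. -/
def fieldInChart (e : OpenPartialHomeomorph M E) (X : ∀ x : M, TangentAt E x) (p : E) : E :=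
  toChart e (e.symm p) (X (e.symm p))

/-- The vector field `X` is smooth on the open set `W`: all its chart representatives are. -/
def IsSmoothFieldOn (X : ∀ x : M, TangentAt E x) (W : Set M) : Prop :=
  ∀ e ∈ atlas E M, IsSmoothOn (fieldInChart e X) (e.target ∩ e.symm ⁻¹' W)

/-- The Lie bracket `[X, Y]` of vector fields: in a chart around `x`,
`[X, Y] = DY · X - DX · Y`. -/
def lieBracket (X Y : ∀ x : M, TangentAt E x) (x : M) : TangentAt E x :=
  ofChart (chartAt E x) x
    (dirDeriv (fieldInChart (chartAt E x) Y) (chartAt E x x)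
        (fieldInChart (chartAt E x) X (chartAt E x x)) -
      dirDeriv (fieldInChart (chartAt E x) X) (chartAt E x x)
        (fieldInChart (chartAt E x) Y (chartAt E x x)))

/-- The representative in the chart `e` of a family `η` of linear functionals on the tangent
spaces, as a function of a point `p ∈ e.target` and a vector `u ∈ E`. -/
def formInChart (e : OpenPartialHomeomorph M E) (η : ∀ x : M, TangentAt E x →ₗ[ℝ] ℝ)
    (p u : E) : ℝ :=
  η (e.symm p) (ofChart e (e.symm p) u)

variable (E M) in
/-- A (kinematic) 1-form on `M`: a smooth function `TM → ℝ` which is linear on each fibre. In the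
chart of `TM` induced by a chart `e` of `M`, smoothness is that of `(p, u) ↦ η_p(u)` on
`e.target × E ⊆ E × E`. (Smoothness forces each functional to be bounded; every smooth 1-form with
continuous functionals on the fibres is of this kind.) -/
structure OneForm where
  /-- The functionals on the tangent spaces. -/
  toFun : ∀ x : M, TangentAt E x →ₗ[ℝ] ℝ
  smooth : ∀ e ∈ atlas E M,
    IsSmoothOn (fun q : E × E => formInChart e toFun q.1 q.2) (e.target ×ˢ (univ : Set E))

/-- The exterior derivative `dη` of a 1-form at `x`, as a function of two tangent vectors at `x`:
in a chart, `dη_p(u, u') = D_u (η(u'))(p) - D_{u'} (η(u))(p)`, where `u, u' ∈ E` are extended to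
constant vector fields. -/
def extDeriv (η : OneForm E M) (x : M) (v w : TangentAt E x) : ℝ :=
  let e := chartAt E x
  dirDeriv (fun p => formInChart e η.toFun p (toChart e x w)) (e x) (toChart e x v) -
    dirDeriv (fun p => formInChart e η.toFun p (toChart e x v)) (e x) (toChart e x w)

/-- The horizontal distribution `ker η`. -/
def horizontal (η : OneForm E M) (x : M) : Set (TangentAt E x) :=
  {v | η.toFun x v = 0}

/-- The vertical distribution `ker dη = ker (v ↦ dη(v, ·))`. -/
def vertical (η : OneForm E M) (x : M) : Set (TangentAt E x) :=
  {v | ∀ w : TangentAt E x, extDeriv η x v w = 0}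

/-- `Δ` is an involutive distribution: each `Δ x` is a linear subspace of the tangent space at `x`
(its dimension may depend on `x`), and the Lie bracket of any two smooth vector fields with values
in `Δ`, defined on the same open set, again has values in `Δ`. -/
structure IsInvolutiveDistribution (Δ : ∀ x : M, Set (TangentAt E x)) : Prop where
  subspace : ∀ x : M, ∃ S : Submodule ℝ (TangentAt E x), (S : Set (TangentAt E x)) = Δ x
  lieBracket_mem : ∀ W : Set M, IsOpen W → ∀ X Y : ∀ x : M, TangentAt E x,
    IsSmoothFieldOn X W → IsSmoothFieldOn Y W →
    (∀ x ∈ W, X x ∈ Δ x) → (∀ x ∈ W, Y x ∈ Δ x) →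
    ∀ x ∈ W, lieBracket X Y x ∈ Δ x

end Manifold

end Convenient

end

open scoped ContDiff

/-! ### Curves through rapidly converging sequences -/

section SpecialCurve

variable {V : Type*} [NormedAddCommGroup V] [NormedSpace ℝ V]

/-! In a chart let `A` represent `η`, and write `[X, Y] = DY·X - DX·Y`. If `A(X)` and `A(Y)` vanish
near `p`, differentiating `A(Y) = 0` along `X` and `A(X) = 0` along `Y` and subtracting gives `dA(X,
Y) + A([X, Y]) = 0`; since `X` lies in `ker dA`, the bracket is horizontal (`apply_bracket`). For
verticality, differentiate `dA(Y, w) = 0` along `X`, `dA(X, w) = 0` along `Y`, and `dA(X, Y p) = 0`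
along `w`, with `w` and `Y p` constant. Closedness of `dA` combines the three into `dA([X, Y], w) =
0` (`localExtDeriv_bracket`).

The weight of the proof is the calculus behind these lines, for maps known only to preserve smooth
curves. Boman's theorem (`CurveSmooth.contDiff`) makes `(s, t) ↦ g (p t + s • u t)` an ordinary
smooth function of two real variables whenever `g` is scalar and smooth (`IsSmoothOn.contDiffAt`).
Additivity of directional derivatives and symmetry of second derivatives are then read off in the
plane. The chain rule follows with Hadamard's lemma `c t = c 0 + t • e t`, and vector-valued
statements reduce to scalar ones by Hahn–Banach.

Membership in `ker dη` at a nearby point refers to that point's own preferred chart, so naturality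
of `d` under chart changes (`localExtDeriv_pullback`) is needed to compute in one chart. -/

theorem summable_two_pow_mul_half_pow_sq (j : ℕ) :
    Summable fun k : ℕ => (4 * 2 ^ k : ℝ) ^ j * (1 / 2) ^ (k ^ 2) := by
  -- With `n = m + j + 1`, the exponent `n ^ 2` contains `n * j`, which cancels `(2 ^ n) ^ j`, and
  -- still leaves at least `m` for a geometric series.
  refine (summable_nat_add_iff (j + 1)).1 ?_
  refine Summable.of_nonneg_of_le (fun _ => by positivity) (fun m => ?_)
    ((summable_geometric_two).mul_left (4 ^ j))
  have h1 : (2 : ℝ) ^ (m + (j + 1)) * (1 / 2) ^ (m + (j + 1)) = 1 := by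
    rw [← mul_pow]; norm_num
  generalize hn : m + (j + 1) = n at h1
  have h2 : n ^ 2 = n * j + ((n * m + j + 1) + m) := by subst hn; ring
  rw [mul_pow, mul_assoc, h2, pow_add, pow_mul, ← mul_assoc (((2 : ℝ) ^ n) ^ j), ← mul_pow, h1,
    one_pow, one_mul, pow_add]
  refine mul_le_mul_of_nonneg_left ?_ (by positivity)
  exact mul_le_of_le_one_left (by positivity) (pow_le_one₀ (by norm_num) (by norm_num))

theorem norm_iteratedFDeriv_bump_smul_le {ψ : ℝ → ℝ} (hψ : ContDiff ℝ ∞ ψ) {j : ℕ} {C : ℝ}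
    (hC : ∀ t, ‖iteratedDeriv j ψ t‖ ≤ C) (a b t : ℝ) (y : V) :
    ‖iteratedFDeriv ℝ j (fun t => ψ (a * (t - b)) • y) t‖ ≤ C * |a| ^ j * ‖y‖ := by
  have h1 : ContDiff ℝ ∞ fun t => ψ (a * (t - b)) := hψ.comp (by fun_prop)
  have h2 := ContinuousLinearMap.norm_iteratedFDeriv_comp_left
    ((1 : ℝ →L[ℝ] ℝ).smulRight y) (h1.contDiffAt (x := t)) (n := j) (by exact_mod_cast le_top)
  have h3 : (((1 : ℝ →L[ℝ] ℝ).smulRight y) ∘ fun t => ψ (a * (t - b)))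
      = fun t => ψ (a * (t - b)) • y := by ext; simp
  rw [h3] at h2
  refine h2.trans ?_
  rw [norm_iteratedFDeriv_eq_norm_iteratedDeriv,
    iteratedDeriv_comp_sub_const (f := fun t => ψ (a * t)) j b,
    iteratedDeriv_comp_const_mul (hψ.of_le (by exact_mod_cast le_top)), norm_mul, norm_pow,
    Real.norm_eq_abs, mul_comm, mul_comm C]
  have h4 : ‖(1 : ℝ →L[ℝ] ℝ).smulRight y‖ = ‖y‖ := by simp
  rw [h4]
  gcongr
  exact hC _

/-- Rescaling by `4 * 2 ^ k` costs a factor `(4 * 2 ^ k) ^ j` in the `j`-th derivative, which the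
decay `(1 / 2) ^ (k ^ 2)` absorbs for every `j`; hence the series may be differentiated termwise. -/
theorem contDiff_tsum_bump [CompleteSpace V] {ψ : ℝ → ℝ} (hψ : ContDiff ℝ ∞ ψ)
    (hc : HasCompactSupport ψ) {y : ℕ → V} {B : ℝ} (hy : ∀ k, ‖y k‖ ≤ B * (1 / 2) ^ (k ^ 2)) :
    ContDiff ℝ ∞ fun t => ∑' k, ψ (4 * 2 ^ k * (t - (1 / 2) ^ k)) • y k := by
  have hb : ∀ j : ℕ, ∃ C, ∀ t, ‖iteratedDeriv j ψ t‖ ≤ C := fun j => by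
    have := (hc.iteratedFDeriv (𝕜 := ℝ) j).exists_bound_of_continuous
      (hψ.continuous_iteratedFDeriv (by exact_mod_cast le_top))
    simpa [norm_iteratedFDeriv_eq_norm_iteratedDeriv] using this
  choose C hC using hb
  have hC0 : ∀ j, 0 ≤ C j := fun j => (norm_nonneg _).trans (hC j 0)
  refine contDiff_tsum (N := (⊤ : ℕ∞))
    (v := fun j k => C j * B * ((4 * 2 ^ k : ℝ) ^ j * (1 / 2) ^ (k ^ 2)))
    (fun k => (hψ.comp (by fun_prop)).smul contDiff_const)
    (fun j _ => (summable_two_pow_mul_half_pow_sq j).mul_left _) fun j k t _ => ?_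
  refine (norm_iteratedFDeriv_bump_smul_le hψ (hC j) _ _ _ _).trans ?_
  rw [abs_of_pos (by positivity)]
  calc C j * (4 * 2 ^ k) ^ j * ‖y k‖ ≤ C j * (4 * 2 ^ k) ^ j * (B * (1 / 2) ^ (k ^ 2)) := by
        gcongr
        · exact mul_nonneg (hC0 j) (by positivity)
        · exact hy k
    _ = _ := by ring

/-- Separates the bumps: close to `(1 / 2) ^ k` every bump of index `m ≠ k` is already off. -/
theorem one_le_abs_four_mul_two_pow {k m : ℕ} (hkm : m ≠ k) {t : ℝ}
    (ht : |t - (1 / 2) ^ k| < (1 / 2) ^ k / 8) : 1 ≤ |4 * 2 ^ m * (t - (1 / 2) ^ m)| := by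
  have hm : (2 : ℝ) ^ m * (1 / 2) ^ m = 1 := by rw [← mul_pow]; norm_num
  have hm0 : (0 : ℝ) < (1 / 2) ^ m := by positivity
  have hk0 : (0 : ℝ) < (1 / 2) ^ k := by positivity
  suffices h : (1 / 2 : ℝ) ^ m ≤ 4 * |t - (1 / 2) ^ m| by
    rw [abs_mul, abs_of_pos (by positivity : (0 : ℝ) < 4 * 2 ^ m)]
    have := mul_le_mul_of_nonneg_left h (by positivity : (0 : ℝ) ≤ 2 ^ m)
    linarith
  rw [abs_lt] at ht
  rcases hkm.lt_or_gt with h | h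
  · have h1 : (1 / 2 : ℝ) ^ k ≤ (1 / 2) ^ (m + 1) :=
      pow_le_pow_of_le_one (by norm_num) (by norm_num) h
    rw [pow_succ] at h1
    have := neg_le_abs (t - (1 / 2) ^ m)
    linarith
  · have h1 : (1 / 2 : ℝ) ^ m ≤ (1 / 2) ^ (k + 1) :=
      pow_le_pow_of_le_one (by norm_num) (by norm_num) h
    rw [pow_succ] at h1
    have := le_abs_self (t - (1 / 2) ^ m)
    linarith

/-- The special curve lemma: a smooth curve passes through the points of a rapidly converging
sequence in a finite time, with small velocities of a given direction. -/
theorem exists_contDiff_curve_through [CompleteSpace V] {x : ℕ → V} {x₀ : V}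
    (hx : ∀ k, ‖x k - x₀‖ ≤ (1 / 2) ^ (k ^ 2)) (v : V) :
    ∃ c : ℝ → V, ContDiff ℝ ∞ c ∧ c 0 = x₀ ∧ ∀ k : ℕ, ∀ᶠ s in 𝓝 (0 : ℝ),
      c ((1 / 2) ^ k + s) = x k + (s * (1 / 2) ^ (k ^ 2)) • v := by
  let φ : ContDiffBump (0 : ℝ) := ⟨1 / 2, 1, by norm_num, by norm_num⟩
  have hφ0 : ∀ s : ℝ, 1 ≤ |s| → φ s = 0 := fun s hs => φ.zero_of_le_dist (by simpa using hs)
  have hφ1 : ∀ s : ℝ, |s| ≤ 1 / 2 → φ s = 1 := fun s hs =>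
    φ.one_of_mem_closedBall (by simpa [φ] using hs)
  have hφ : ContDiff ℝ ∞ φ := φ.contDiff
  -- Near the `k`-th node `s * φ s`, rescaled, contributes `4 * 2 ^ k * s`; the factor `(1 / 4) * (1
  -- / 2) ^ k` cancels this slope, so the velocity there is exactly `(1 / 2) ^ (k ^ 2) • v`.
  let y : ℕ → V := fun k => ((1 / 2 : ℝ) ^ (k ^ 2) * ((1 / 4) * (1 / 2) ^ k)) • v
  have hy : ∀ k, ‖y k‖ ≤ ‖v‖ * (1 / 2) ^ (k ^ 2) := fun k => by
    simp only [y, norm_smul, Real.norm_eq_abs]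
    rw [abs_of_pos (by positivity), mul_comm ‖v‖]
    refine mul_le_mul_of_nonneg_right ?_ (norm_nonneg _)
    refine mul_le_of_le_one_right (by positivity) ?_
    have : (1 / 2 : ℝ) ^ k ≤ 1 := pow_le_one₀ (by norm_num) (by norm_num)
    linarith
  let S : (ℝ → ℝ) → (ℕ → V) → ℝ → V := fun ψ z t => ∑' k, ψ (4 * 2 ^ k * (t - (1 / 2) ^ k)) • z k
  have hS0 : ∀ (ψ : ℝ → ℝ) (z : ℕ → V), (∀ s, 1 ≤ |s| → ψ s = 0) → S ψ z 0 = 0 := by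
    intro ψ z h
    simp only [S]
    rw [tsum_congr (fun k => ?_), tsum_zero]
    rw [h, zero_smul]
    have : (2 : ℝ) ^ k * (1 / 2) ^ k = 1 := by rw [← mul_pow]; norm_num
    rw [show 4 * 2 ^ k * (0 - (1 / 2 : ℝ) ^ k) = - (4 * (2 ^ k * (1 / 2) ^ k)) by ring, this]
    norm_num
  have hSk : ∀ (ψ : ℝ → ℝ) (z : ℕ → V), (∀ s, 1 ≤ |s| → ψ s = 0) → ∀ (k : ℕ) (s : ℝ),
      |s| < (1 / 2) ^ k / 8 → S ψ z ((1 / 2) ^ k + s) = ψ (4 * 2 ^ k * s) • z k := by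
    intro ψ z h k s hs
    simp only [S]
    rw [tsum_eq_single k]
    · simp
    · intro m hm
      rw [h, zero_smul]
      exact one_le_abs_four_mul_two_pow hm (by simpa using hs)
  have hψ0 : ∀ s, 1 ≤ |s| → s * φ s = 0 := fun s hs => by rw [hφ0 s hs, mul_zero]
  refine ⟨fun t => x₀ + S φ (fun k => x k - x₀) t + S (fun s => s * φ s) y t, ?_, ?_, ?_⟩
  · refine (contDiff_const.add ?_).add ?_
    · exact contDiff_tsum_bump hφ φ.hasCompactSupport (B := 1) (by simpa using hx)
    · exact contDiff_tsum_bump (contDiff_id.mul hφ) (φ.hasCompactSupport.mul_left) hy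
  · simp only [hS0 _ _ hφ0, hS0 _ _ hψ0, add_zero]
  · intro k
    have hpos : (0 : ℝ) < (1 / 2) ^ k / 8 := by positivity
    filter_upwards [Metric.ball_mem_nhds (0 : ℝ) hpos] with s hs
    have hs' : |s| < (1 / 2) ^ k / 8 := by simpa using hs
    have h2 : (2 : ℝ) ^ k * (1 / 2) ^ k = 1 := by rw [← mul_pow]; norm_num
    have h1 : |4 * 2 ^ k * s| ≤ 1 / 2 := by
      rw [abs_mul, abs_of_pos (by positivity : (0 : ℝ) < 4 * 2 ^ k)]
      have := mul_le_mul_of_nonneg_left hs'.le (by positivity : (0 : ℝ) ≤ 2 ^ k)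
      linarith
    simp only [hSk _ _ hφ0 k s hs', hSk _ _ hψ0 k s hs', hφ1 _ h1, y, smul_smul]
    rw [one_smul, add_sub_cancel]
    congr 2
    calc 4 * 2 ^ k * s * 1 * ((1 / 2) ^ k ^ 2 * (1 / 4 * (1 / 2) ^ k))
        = s * (1 / 2) ^ k ^ 2 * (2 ^ k * (1 / 2) ^ k) := by ring
      _ = _ := by rw [h2, mul_one]

end SpecialCurve

theorem exists_seq_of_frequently {V : Type*} [SeminormedAddCommGroup V] {P : ℕ → V → Prop} {x₀ : V}
    (hP : ∀ k, ∃ᶠ x in 𝓝 x₀, P k x) :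
    ∃ x : ℕ → V, (∀ k, ‖x k - x₀‖ ≤ (1 / 2) ^ (k ^ 2)) ∧ ∀ k, P k (x k) := by
  have : ∀ k : ℕ, ∃ x, ‖x - x₀‖ ≤ (1 / 2) ^ (k ^ 2) ∧ P k x := fun k => by
    obtain ⟨x, hx, hx'⟩ := ((hP k).and_eventually
      (Metric.closedBall_mem_nhds x₀ (ε := (1 / 2) ^ (k ^ 2)) (by positivity))).exists
    exact ⟨x, by simpa [dist_eq_norm] using hx', hx⟩
  choose x h1 h2 using this
  exact ⟨x, h1, h2⟩

/-! ### Maps preserving smooth curves: continuity and locally bounded line derivatives -/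

section CurveSmooth

variable {V : Type*} [NormedAddCommGroup V] [NormedSpace ℝ V]
  {G : Type*} [NormedAddCommGroup G] [NormedSpace ℝ G]

/-- The map `h` between normed spaces maps smooth curves to smooth curves. -/
def CurveSmooth (h : V → G) : Prop :=
  ∀ c : ℝ → V, ContDiff ℝ ∞ c → ContDiff ℝ ∞ fun t => h (c t)

/-- The `n`-th derivative at `x` of `h` along the line through `x` in the direction `v`. -/
noncomputable def lineIterDeriv (h : V → G) (v : V) (n : ℕ) (x : V) : G :=
  iteratedDeriv n (fun t : ℝ => h (x + t • v)) 0

theorem CurveSmooth.contDiff_line {h : V → G} (hh : CurveSmooth h) (x v : V) :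
    ContDiff ℝ ∞ fun t : ℝ => h (x + t • v) :=
  hh _ (by fun_prop)

theorem CurveSmooth.hasLineDerivAt {h : V → G} (hh : CurveSmooth h) (v : V) (n : ℕ) (x : V) :
    HasLineDerivAt ℝ (lineIterDeriv h v n) (lineIterDeriv h v (n + 1) x) x v := by
  have h1 : (fun t : ℝ => lineIterDeriv h v n (x + t • v))
      = iteratedDeriv n (fun t : ℝ => h (x + t • v)) := by
    ext t
    have := congrFun (iteratedDeriv_comp_const_add n (fun s : ℝ => h (x + s • v)) t) 0
    simp only [add_zero] at this
    rw [← this]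
    simp only [lineIterDeriv, add_smul, add_assoc]
  rw [HasLineDerivAt, h1, lineIterDeriv, iteratedDeriv_succ]
  refine DifferentiableAt.hasDerivAt ?_
  exact ((hh.contDiff_line x v).differentiable_iteratedDeriv n
    (by exact_mod_cast WithTop.coe_lt_top _)).differentiableAt

theorem tendsto_half_pow : Tendsto (fun k : ℕ => (1 / 2 : ℝ) ^ k) atTop (𝓝 0) :=
  tendsto_pow_atTop_nhds_zero_of_lt_one (by norm_num) (by norm_num)

theorem CurveSmooth.continuous [CompleteSpace V] {h : V → G} (hh : CurveSmooth h) :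
    Continuous h := by
  refine continuous_iff_continuousAt.2 fun x₀ => Metric.tendsto_nhds.2 fun ε hε => ?_
  by_contra hcon
  obtain ⟨x, hx, hx'⟩ := exists_seq_of_frequently
    (P := fun _ x => ¬ dist (h x) (h x₀) < ε) fun _ => not_eventually.1 hcon
  obtain ⟨c, hc, hc0, hck⟩ := exists_contDiff_curve_through hx 0
  have h1 : Tendsto (fun k : ℕ => h (c ((1 / 2) ^ k))) atTop (𝓝 (h x₀)) := by
    have := ((hh c hc).continuous.tendsto 0).comp tendsto_half_pow
    simpa [hc0, Function.comp_def] using this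
  have h2 : ∀ k : ℕ, c ((1 / 2) ^ k) = x k := fun k => by simpa using (hck k).self_of_nhds
  simp only [h2] at h1
  obtain ⟨k, hk⟩ := (Metric.tendsto_nhds.1 h1 ε hε).exists
  exact hx' k hk

/-- Otherwise there are rapidly converging points `x k` where the derivative exceeds `k * (2 ^ (k ^
2)) ^ n`. A special curve crosses `x k` at time `(1 / 2) ^ k` with velocity `(1 / 2) ^ (k ^ 2) • v`,
so the `n`-th derivative of `h ∘ c` there exceeds `k`, against its continuity at `0`. -/
theorem CurveSmooth.exists_eventually_norm_lineIterDeriv_le [CompleteSpace V] {h : V → G}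
    (hh : CurveSmooth h) (v : V) (n : ℕ) (x₀ : V) :
    ∃ C, ∀ᶠ x in 𝓝 x₀, ‖lineIterDeriv h v n x‖ ≤ C := by
  by_contra! hcon
  obtain ⟨x, hx, hx'⟩ := exists_seq_of_frequently
    (P := fun k x => ¬ ‖lineIterDeriv h v n x‖ ≤ k * (2 ^ (k ^ 2)) ^ n) fun k => by
      simpa using hcon _
  obtain ⟨c, hc, -, hck⟩ := exists_contDiff_curve_through hx v
  have hder : ∀ k : ℕ, iteratedDeriv n (fun t => h (c t)) ((1 / 2) ^ k)
      = ((1 / 2 : ℝ) ^ (k ^ 2)) ^ n • lineIterDeriv h v n (x k) := fun k => by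
    have h1 := congrFun (iteratedDeriv_comp_const_add n (fun t => h (c t)) ((1 / 2 : ℝ) ^ k)) 0
    simp only [add_zero] at h1
    have h2 : (fun z => h (c ((1 / 2 : ℝ) ^ k + z)))
        =ᶠ[𝓝 0] fun s => h (x k + ((1 / 2 : ℝ) ^ (k ^ 2) * s) • v) := by
      filter_upwards [hck k] with s hs
      rw [hs, mul_comm]
    rw [← h1, h2.iteratedDeriv_eq, iteratedDeriv_comp_const_smul
      (f := fun s : ℝ => h (x k + s • v))
      ((hh.contDiff_line _ _).of_le (by exact_mod_cast le_top))]
    simp [lineIterDeriv]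
  have h3 := ((hh c hc).continuous_iteratedDeriv n (by exact_mod_cast le_top)).tendsto 0
  have h4 := (h3.comp tendsto_half_pow).norm
  have h5 : ∀ᶠ k : ℕ in atTop, (k : ℝ) ≤ ‖iteratedDeriv n (fun t => h (c t)) 0‖ + 1 := by
    filter_upwards [h4.eventually_lt_const (lt_add_one _)] with k hk
    refine le_trans ?_ hk.le
    simp only [Function.comp_def, hder, norm_smul, Real.norm_eq_abs]
    rw [abs_of_pos (by positivity)]
    have h6 : ((1 / 2 : ℝ) ^ (k ^ 2)) ^ n * (2 ^ (k ^ 2)) ^ n = 1 := by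
      rw [← mul_pow, ← mul_pow]; norm_num
    calc (k : ℝ) = ((1 / 2 : ℝ) ^ (k ^ 2)) ^ n * (k * (2 ^ (k ^ 2)) ^ n) := by
          rw [mul_left_comm, h6, mul_one]
      _ ≤ _ := by
          gcongr
          exact (not_le.1 (hx' k)).le
  have h6 := (tendsto_natCast_atTop_atTop (R := ℝ)).eventually_gt_atTop
    (‖iteratedDeriv n (fun t => h (c t)) 0‖ + 1)
  obtain ⟨k, hk1, hk2⟩ := (h5.and h6).exists
  exact absurd hk1 (not_le.2 hk2)

/-- Continuity of the line derivatives is not yet available; measurability passes to pointwise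
limits of difference quotients and is enough to integrate. -/
theorem CurveSmooth.measurable_lineIterDeriv [CompleteSpace V] [MeasurableSpace V] [BorelSpace V]
    [MeasurableSpace G] [BorelSpace G] [SecondCountableTopology G] {h : V → G}
    (hh : CurveSmooth h) (v : V) (n : ℕ) : Measurable (lineIterDeriv h v n) := by
  induction n with
  | zero =>
    have : lineIterDeriv h v 0 = h := by ext; simp [lineIterDeriv]
    rw [this]
    exact hh.continuous.measurable
  | succ n ih =>
    have hlim : ∀ x, Tendsto (fun k : ℕ => ((1 / 2 : ℝ) ^ k)⁻¹ •
        (lineIterDeriv h v n (x + ((1 / 2 : ℝ) ^ k) • v) - lineIterDeriv h v n x)) atTop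
        (𝓝 (lineIterDeriv h v (n + 1) x)) := fun x => by
      have := (hasDerivAt_iff_tendsto_slope_zero.1 (hh.hasLineDerivAt v n x)).comp
        (tendsto_nhdsWithin_iff.2 ⟨tendsto_half_pow, Eventually.of_forall fun k => by
          simp⟩)
      simpa [Function.comp_def] using this
    refine measurable_of_tendsto_metrizable (fun k => ?_) (tendsto_pi_nhds.2 hlim)
    exact ((ih.comp (measurable_id.add_const _)).sub ih).const_smul _

theorem lineIterDeriv_eq_zero_of_notMem_tsupport {h : V → G} (v : V) (n : ℕ) {x : V}
    (hx : x ∉ tsupport h) : lineIterDeriv h v n x = 0 := by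
  have h1 : (fun t : ℝ => h (x + t • v)) =ᶠ[𝓝 0] fun _ => 0 := by
    have h2 : Tendsto (fun t : ℝ => x + t • v) (𝓝 0) (𝓝 x) := by
      have : Continuous fun t : ℝ => x + t • v := by fun_prop
      simpa using this.tendsto 0
    exact h2.eventually (notMem_tsupport_iff_eventuallyEq.1 hx)
  rw [lineIterDeriv, h1.iteratedDeriv_eq]
  simp

theorem CurveSmooth.exists_norm_lineIterDeriv_le [CompleteSpace V] {h : V → G}
    (hh : CurveSmooth h) (hc : HasCompactSupport h) (v : V) (n : ℕ) :
    ∃ C, ∀ x, ‖lineIterDeriv h v n x‖ ≤ C := by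
  have : ∃ C, ∀ x ∈ tsupport h, ‖lineIterDeriv h v n x‖ ≤ C := by
    refine hc.isCompact.induction_on (p := fun s => ∃ C, ∀ x ∈ s, ‖lineIterDeriv h v n x‖ ≤ C)
      ⟨0, by simp⟩ (fun s t hst ⟨C, hC⟩ => ⟨C, fun x hx => hC x (hst hx)⟩) ?_ ?_
    · rintro s t ⟨C, hC⟩ ⟨D, hD⟩
      refine ⟨max C D, fun x hx => ?_⟩
      rcases hx with hx | hx
      · exact (hC x hx).trans (le_max_left _ _)
      · exact (hD x hx).trans (le_max_right _ _)
    · intro x _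
      obtain ⟨C, hC⟩ := hh.exists_eventually_norm_lineIterDeriv_le v n x
      exact ⟨_, mem_nhdsWithin_of_mem_nhds hC, C, fun _ h => h⟩
  obtain ⟨C, hC⟩ := this
  refine ⟨max C 0, fun x => ?_⟩
  by_cases hx : x ∈ tsupport h
  · exact (hC x hx).trans (le_max_left _ _)
  · rw [lineIterDeriv_eq_zero_of_notMem_tsupport v n hx, norm_zero]
    exact le_max_right _ _

end CurveSmooth

/-! ### Boman's theorem by Fourier analysis -/

section Boman
open MeasureTheory FourierTransform

theorem hasLineDerivAt_fourierChar_neg_inner {V : Type*} [NormedAddCommGroup V]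
    [InnerProductSpace ℝ V] (ξ v x : V) :
    HasLineDerivAt ℝ (fun x => (𝐞 (-inner ℝ x ξ) : ℂ))
      (-(2 * Real.pi * Complex.I * inner ℝ v ξ) * (𝐞 (-inner ℝ x ξ) : ℂ)) x v := by
  rw [HasLineDerivAt]
  have h1 : HasDerivAt (fun t : ℝ => -inner ℝ (x + t • v) ξ) (-inner ℝ v ξ) 0 := by
    have : (fun t : ℝ => -inner ℝ (x + t • v) ξ)
        = fun t : ℝ => -inner ℝ x ξ + t * (-inner ℝ v ξ) := by
      ext t
      rw [inner_add_left, real_inner_smul_left]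
      ring
    rw [this]
    simpa using ((hasDerivAt_id (0 : ℝ)).mul_const (-inner ℝ v ξ)).const_add (-inner ℝ x ξ)
  have h2 := (Real.hasDerivAt_fourierChar (-inner ℝ (x + (0 : ℝ) • v) ξ)).scomp 0 h1
  refine h2.congr_deriv ?_
  rw [zero_smul, add_zero, Complex.real_smul]
  push_cast
  ring

variable {V : Type*} [NormedAddCommGroup V] [InnerProductSpace ℝ V] [FiniteDimensional ℝ V]
  [MeasurableSpace V] [BorelSpace V]

theorem CurveSmooth.integrable_lineIterDeriv {f : V → ℂ} (hf : CurveSmooth f)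
    (hc : HasCompactSupport f) (v : V) (n : ℕ) : Integrable (lineIterDeriv f v n) := by
  obtain ⟨C, hC⟩ := hf.exists_norm_lineIterDeriv_le hc v n
  rw [← integrableOn_iff_integrable_of_support_subset (s := tsupport f)]
  · exact Measure.integrableOn_of_bounded hc.isCompact.measure_lt_top.ne
      (hf.measurable_lineIterDeriv v n).aestronglyMeasurable (Eventually.of_forall hC)
  · intro x hx
    by_contra h
    exact hx (lineIterDeriv_eq_zero_of_notMem_tsupport v n h)

/-- Integration by parts along `v` against the character; no boundary terms arise because all
products are integrable. -/
theorem CurveSmooth.fourier_lineIterDeriv_succ {f : V → ℂ} (hf : CurveSmooth f)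
    (hc : HasCompactSupport f) (v : V) (n : ℕ) (ξ : V) :
    𝓕 (lineIterDeriv f v (n + 1)) ξ
      = (2 * Real.pi * Complex.I * inner ℝ v ξ) * 𝓕 (lineIterDeriv f v n) ξ := by
  have hcont : Continuous fun x : V => (𝐞 (-inner ℝ x ξ) : ℂ) := by
    have := Real.continuous_fourierChar
    fun_prop
  have hint : ∀ n, Integrable fun x => (𝐞 (-inner ℝ x ξ) : ℂ) * lineIterDeriv f v n x := fun n =>
    (hf.integrable_lineIterDeriv hc v n).bdd_mul hcont.aestronglyMeasurable
      (Eventually.of_forall fun x => (Circle.norm_coe _).le)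
  have key := integral_bilinear_hasLineDerivAt_right_eq_neg_left_of_integrable (μ := volume)
    (f := fun x : V => (𝐞 (-inner ℝ x ξ) : ℂ)) (g := lineIterDeriv f v n)
    (g' := lineIterDeriv f v (n + 1)) (v := v) (B := ContinuousLinearMap.mul ℝ ℂ)
    (f' := fun x => -(2 * Real.pi * Complex.I * inner ℝ v ξ) * (𝐞 (-inner ℝ x ξ) : ℂ))
    (by simpa [mul_assoc] using (hint n).const_mul (-(2 * Real.pi * Complex.I * inner ℝ v ξ)))
    (hint (n + 1)) (hint n)
    (fun x _ => hasLineDerivAt_fourierChar_neg_inner ξ v x) (fun x _ => hf.hasLineDerivAt v n x)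
  simp only [ContinuousLinearMap.mul_apply', mul_assoc, neg_mul, integral_neg, neg_neg] at key
  simp only [Real.fourier_eq, Circle.smul_def, smul_eq_mul, key, ← integral_const_mul, mul_assoc]

theorem CurveSmooth.exists_abs_inner_pow_mul_norm_fourier_le {f : V → ℂ} (hf : CurveSmooth f)
    (hc : HasCompactSupport f) (v : V) (n : ℕ) :
    ∃ C, ∀ ξ, |inner ℝ v ξ| ^ n * ‖𝓕 f ξ‖ ≤ C := by
  have h0 : lineIterDeriv f v 0 = f := by ext; simp [lineIterDeriv]
  have h1 : ∀ ξ, 𝓕 (lineIterDeriv f v n) ξ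
      = (2 * Real.pi * Complex.I * inner ℝ v ξ) ^ n * 𝓕 f ξ := fun ξ => by
    induction n with
    | zero => simp [h0]
    | succ n ih => rw [hf.fourier_lineIterDeriv_succ hc, ih, pow_succ']; ring
  refine ⟨∫ x, ‖lineIterDeriv f v n x‖, fun ξ => ?_⟩
  have h2 : ‖𝓕 (lineIterDeriv f v n) ξ‖ ≤ ∫ x, ‖lineIterDeriv f v n x‖ := by
    rw [Real.fourier_eq]
    refine (norm_integral_le_integral_norm _).trans (le_of_eq ?_)
    simp [Circle.norm_smul]
  refine le_trans ?_ h2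
  rw [h1, norm_mul, norm_pow]
  gcongr
  rw [norm_mul, norm_mul, norm_mul, Complex.norm_I, Complex.norm_real, Complex.norm_real,
    mul_one, Real.norm_eq_abs, Real.norm_eq_abs, abs_of_pos Real.pi_pos]
  have := Real.pi_gt_three
  refine le_mul_of_one_le_left (abs_nonneg _) ?_
  simp
  linarith

/-- Decay in each direction of an orthonormal basis gives decay in norm, by the power mean
inequality applied to `‖ξ‖ ≤ ∑ |⟨b i, ξ⟩|`. -/
theorem CurveSmooth.exists_norm_pow_mul_norm_fourier_le {f : V → ℂ} (hf : CurveSmooth f)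
    (hc : HasCompactSupport f) (n : ℕ) : ∃ C, ∀ ξ, ‖ξ‖ ^ n * ‖𝓕 f ξ‖ ≤ C := by
  let b := stdOrthonormalBasis ℝ V
  rcases n with _ | n
  · exact ⟨_, fun ξ => by
      simpa using (hf.exists_abs_inner_pow_mul_norm_fourier_le hc 0 0).choose_spec ξ⟩
  choose C hC using fun i => hf.exists_abs_inner_pow_mul_norm_fourier_le hc (b i) (n + 1)
  let d : ℝ := (Finset.univ : Finset (Fin (Module.finrank ℝ V))).card
  refine ⟨d ^ n * ∑ i, C i, fun ξ => ?_⟩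
  have h1 : ‖ξ‖ ≤ ∑ i, |inner ℝ (b i) ξ| := by
    conv_lhs => rw [← b.sum_repr' ξ]
    refine (norm_sum_le _ _).trans (Finset.sum_le_sum fun i _ => ?_)
    rw [norm_smul, b.norm_eq_one, mul_one, Real.norm_eq_abs]
  have h2 : (∑ i, |inner ℝ (b i) ξ|) ^ (n + 1) ≤ d ^ n * ∑ i, |inner ℝ (b i) ξ| ^ (n + 1) := by
    have := pow_sum_div_card_le_sum_pow (s := (Finset.univ : Finset (Fin (Module.finrank ℝ V))))
      (f := fun i => |inner ℝ (b i) ξ|) (fun i _ => abs_nonneg _) n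
    by_cases hd : d = 0
    · have : IsEmpty (Fin (Module.finrank ℝ V)) := by
        rw [← Finset.univ_eq_empty_iff, ← Finset.card_eq_zero]
        simpa [d] using hd
      simp
    · have hd' : 0 < d ^ n := pow_pos (lt_of_le_of_ne (Nat.cast_nonneg _) (Ne.symm hd)) _
      rwa [div_le_iff₀' hd'] at this
  calc ‖ξ‖ ^ (n + 1) * ‖𝓕 f ξ‖ ≤ (d ^ n * ∑ i, |inner ℝ (b i) ξ| ^ (n + 1)) * ‖𝓕 f ξ‖ := by
        gcongr
        exact (pow_le_pow_left₀ (norm_nonneg _) h1 _).trans h2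
    _ = d ^ n * ∑ i, |inner ℝ (b i) ξ| ^ (n + 1) * ‖𝓕 f ξ‖ := by
        rw [mul_assoc, Finset.sum_mul]
    _ ≤ _ := by
        gcongr with i
        exact hC i ξ

theorem CurveSmooth.integrable_norm_pow_mul_norm_fourier {f : V → ℂ} (hf : CurveSmooth f)
    (hc : HasCompactSupport f) (n : ℕ) : Integrable fun ξ => ‖ξ‖ ^ n * ‖𝓕 f ξ‖ := by
  have hfi : Integrable f := hf.continuous.integrable_of_hasCompactSupport hc
  have hcont : Continuous (𝓕 f) :=
    VectorFourier.fourierIntegral_continuous Real.continuous_fourierChar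
      (innerSL ℝ).continuous₂ hfi
  -- One more than the dimension, which makes `(1 + ‖ξ‖) ^ (-d)` integrable; decay of orders `n` and
  -- `d + n` then dominates the integrand.
  let d := Module.finrank ℝ V + 1
  obtain ⟨C, hC⟩ := hf.exists_norm_pow_mul_norm_fourier_le hc n
  obtain ⟨D, hD⟩ := hf.exists_norm_pow_mul_norm_fourier_le hc (d + n)
  have hint : Integrable fun ξ : V => (2 ^ (d - 1) * (C + D)) * (1 + ‖ξ‖) ^ (-(d : ℝ)) :=
    (integrable_one_add_norm (by simp [d])).const_mul _
  refine hint.mono' (by fun_prop) (Eventually.of_forall fun ξ => ?_)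
  rw [Real.norm_of_nonneg (by positivity), Real.rpow_neg (by positivity), Real.rpow_natCast,
    ← div_eq_mul_inv, le_div_iff₀ (by positivity)]
  have h1 := add_pow_le zero_le_one (norm_nonneg ξ) d
  rw [one_pow] at h1
  calc ‖ξ‖ ^ n * ‖𝓕 f ξ‖ * (1 + ‖ξ‖) ^ d
      ≤ ‖ξ‖ ^ n * ‖𝓕 f ξ‖ * (2 ^ (d - 1) * (1 + ‖ξ‖ ^ d)) := by gcongr
    _ = 2 ^ (d - 1) * (‖ξ‖ ^ n * ‖𝓕 f ξ‖ + ‖ξ‖ ^ (d + n) * ‖𝓕 f ξ‖) := by ring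
    _ ≤ _ := by gcongr <;> simp [hC, hD]

/-- All moments of `𝓕 f` are integrable, so its Fourier transform is smooth, and by inversion that
transform is `f` up to reflection. -/
theorem CurveSmooth.contDiff_of_hasCompactSupport {f : V → ℂ} (hf : CurveSmooth f)
    (hc : HasCompactSupport f) : ContDiff ℝ ∞ f := by
  have hfi : Integrable f := hf.continuous.integrable_of_hasCompactSupport hc
  have hcont : Continuous (𝓕 f) :=
    VectorFourier.fourierIntegral_continuous Real.continuous_fourierChar
      (innerSL ℝ).continuous₂ hfi
  have hint : Integrable (𝓕 f) := by
    rw [← integrable_norm_iff hcont.aestronglyMeasurable]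
    simpa using hf.integrable_norm_pow_mul_norm_fourier hc 0
  have h1 : ContDiff ℝ ∞ (𝓕 (𝓕 f)) :=
    Real.contDiff_fourier (N := ⊤) fun n _ => hf.integrable_norm_pow_mul_norm_fourier hc n
  rw [← hf.continuous.fourierInv_fourier_eq hfi hint]
  have h2 : 𝓕⁻ (𝓕 f) = fun x => 𝓕 (𝓕 f) (-x) := by
    ext x
    rw [Real.fourierInv_eq_fourier_neg]
  rw [h2]
  exact h1.comp contDiff_neg

end Boman

/-- **Boman's theorem**: a real function on a finite-dimensional space which is smooth along all
smooth curves is smooth. -/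
theorem CurveSmooth.contDiff {V : Type*} [NormedAddCommGroup V] [NormedSpace ℝ V]
    [FiniteDimensional ℝ V] {h : V → ℝ} (hh : CurveSmooth h) : ContDiff ℝ ∞ h := by
  let L : V ≃L[ℝ] EuclideanSpace ℝ (Fin (Module.finrank ℝ V)) := toEuclidean
  have key : ContDiff ℝ ∞ (h ∘ L.symm) := by
    refine contDiff_iff_contDiffAt.2 fun x => ?_
    -- Smoothness is local: multiplying by a bump equal to `1` near `x` reduces to compact support.
    let φ : ContDiffBump x := default
    let f : EuclideanSpace ℝ (Fin (Module.finrank ℝ V)) → ℂ := fun y => (φ y * h (L.symm y) : ℝ)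
    have hf : CurveSmooth f := fun c hc => by
      refine Complex.ofRealCLM.contDiff.comp ?_
      exact (φ.contDiff.comp hc).mul (hh _ (L.symm.contDiff.comp hc))
    have hfc : HasCompactSupport f := by
      have : HasCompactSupport fun y => φ y * h (L.symm y) := φ.hasCompactSupport.mul_right
      exact this.comp_left (g := fun r : ℝ => (r : ℂ)) (by simp)
    have h1 : ContDiff ℝ ∞ fun y => (f y).re :=
      Complex.reCLM.contDiff.comp (hf.contDiff_of_hasCompactSupport hfc)
    refine h1.contDiffAt.congr_of_eventuallyEq ?_
    filter_upwards [φ.eventuallyEq_one] with y hy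
    simp [f, hy]
  have : h = (h ∘ L.symm) ∘ L := by ext; simp
  rw [this]
  exact key.comp L.contDiff

namespace Convenient

/-! ### Derivatives of curves in topological vector spaces -/

section CurveCalculus

variable {F : Type*} [AddCommGroup F] [Module ℝ F] [TopologicalSpace F]

theorem hasCurveDerivAt_iff_hasDerivAt {G : Type*} [NormedAddCommGroup G] [NormedSpace ℝ G]
    {c : ℝ → G} {v : G} {t : ℝ} : HasCurveDerivAt c v t ↔ HasDerivAt c v t :=
  hasDerivAt_iff_tendsto_slope_zero.symm

theorem HasCurveDerivAt.curveDeriv_eq [T2Space F] {c : ℝ → F} {v : F} {t : ℝ}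
    (h : HasCurveDerivAt c v t) : curveDeriv c t = v :=
  Tendsto.limUnder_eq h

theorem HasCurveDerivAt.unique [T2Space F] {c : ℝ → F} {v w : F} {t : ℝ}
    (h : HasCurveDerivAt c v t) (h' : HasCurveDerivAt c w t) : v = w :=
  tendsto_nhds_unique h h'

theorem HasCurveDerivAt.congr_of_eventuallyEq {c e : ℝ → F} {v : F} {t : ℝ}
    (h : HasCurveDerivAt c v t) (he : e =ᶠ[𝓝 t] c) : HasCurveDerivAt e v t := by
  refine Tendsto.congr' ?_ h
  have h1 : Tendsto (fun δ : ℝ => t + δ) (𝓝[≠] 0) (𝓝 t) := by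
    refine Tendsto.mono_left ?_ nhdsWithin_le_nhds
    have : Continuous fun δ : ℝ => t + δ := by fun_prop
    simpa using this.tendsto 0
  filter_upwards [h1.eventually he] with δ hδ
  rw [hδ, he.self_of_nhds]

theorem hasCurveDerivAt_comp_const_add {c : ℝ → F} {v : F} {t s : ℝ} :
    HasCurveDerivAt (fun τ => c (s + τ)) v t ↔ HasCurveDerivAt c v (s + t) := by
  simp only [HasCurveDerivAt, add_assoc]

/-- Carathéodory's form of differentiability. -/
theorem hasCurveDerivAt_iff_exists {c : ℝ → F} {v : F} {t : ℝ} :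
    HasCurveDerivAt c v t ↔
      ∃ q : ℝ → F, ContinuousAt q 0 ∧ q 0 = v ∧ ∀ δ, c (t + δ) - c t = δ • q δ := by
  constructor
  · intro h
    refine ⟨Function.update (fun δ : ℝ => δ⁻¹ • (c (t + δ) - c t)) 0 v,
      continuousAt_update_same.2 h, by simp, fun δ => ?_⟩
    rcases eq_or_ne δ 0 with rfl | hδ
    · simp
    · rw [Function.update_of_ne hδ, smul_inv_smul₀ hδ]
  · rintro ⟨q, hq, rfl, h⟩
    refine Tendsto.congr' ?_ (hq.tendsto.mono_left nhdsWithin_le_nhds)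
    filter_upwards [self_mem_nhdsWithin] with δ hδ
    rw [h, inv_smul_smul₀ hδ]

theorem hasCurveDerivAt_const (w : F) (t : ℝ) : HasCurveDerivAt (fun _ => w) 0 t :=
  hasCurveDerivAt_iff_exists.2 ⟨fun _ => 0, continuousAt_const, rfl, fun δ => by simp⟩

theorem HasCurveDerivAt.prodMk {E : Type*} [AddCommGroup E] [Module ℝ E] [TopologicalSpace E]
    {c : ℝ → E} {e : ℝ → F} {v : E} {w : F} {t : ℝ} (hc : HasCurveDerivAt c v t)
    (he : HasCurveDerivAt e w t) : HasCurveDerivAt (fun t => (c t, e t)) (v, w) t :=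
  Tendsto.prodMk_nhds hc he

theorem HasCurveDerivAt.clm_comp {E : Type*} [AddCommGroup E] [Module ℝ E] [TopologicalSpace E]
    {c : ℝ → E} {v : E} {t : ℝ} (hc : HasCurveDerivAt c v t) (L : E →L[ℝ] F) :
    HasCurveDerivAt (fun t => L (c t)) (L v) t := by
  simpa [HasCurveDerivAt, Function.comp_def] using (L.continuous.tendsto v).comp hc

theorem HasCurveDerivAt.comp [ContinuousSMul ℝ F] {a : ℝ → ℝ} {c : ℝ → F} {r : ℝ} {v : F} {t : ℝ}
    (hc : HasCurveDerivAt c v (a t)) (ha : HasDerivAt a r t) :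
    HasCurveDerivAt (fun t => c (a t)) (r • v) t := by
  obtain ⟨p, hp, rfl, h⟩ := hasCurveDerivAt_iff_exists.1 (hasCurveDerivAt_iff_hasDerivAt.2 ha)
  obtain ⟨q, hq, rfl, h'⟩ := hasCurveDerivAt_iff_exists.1 hc
  refine hasCurveDerivAt_iff_exists.2 ⟨fun δ => p δ • q (δ * p δ), ?_, by simp, fun δ => ?_⟩
  · have h1 : ContinuousAt (fun δ => δ * p δ) 0 := by fun_prop
    have h2 : ContinuousAt (fun δ => q (δ * p δ)) 0 :=
      ContinuousAt.comp (f := fun δ => δ * p δ) (by simpa using hq) h1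
    exact hp.smul h2
  · have h1 : a (t + δ) = a t + δ * p δ := by rw [← smul_eq_mul, ← h]; ring
    rw [h1, h', smul_smul]

variable [IsTopologicalAddGroup F]

theorem HasCurveDerivAt.add {c e : ℝ → F} {v w : F} {t : ℝ} (hc : HasCurveDerivAt c v t)
    (he : HasCurveDerivAt e w t) : HasCurveDerivAt (fun t => c t + e t) (v + w) t := by
  refine (Tendsto.add hc he).congr fun δ => ?_
  rw [← smul_add, add_sub_add_comm]

variable [ContinuousSMul ℝ F]

theorem HasCurveDerivAt.continuousAt {c : ℝ → F} {v : F} {t : ℝ} (hc : HasCurveDerivAt c v t) :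
    ContinuousAt c t := by
  obtain ⟨q, hq, -, h⟩ := hasCurveDerivAt_iff_exists.1 hc
  have h1 : ContinuousAt (fun δ => c t + δ • q δ) 0 := by fun_prop
  have h2 : c = (fun δ => c t + δ • q δ) ∘ fun s => s - t := by
    ext s
    simp [← h]
  rw [h2]
  exact ContinuousAt.comp (by simpa using h1) (by fun_prop)

theorem HasCurveDerivAt.smul {a : ℝ → ℝ} {c : ℝ → F} {r : ℝ} {v : F} {t : ℝ}
    (ha : HasDerivAt a r t) (hc : HasCurveDerivAt c v t) :
    HasCurveDerivAt (fun t => a t • c t) (r • c t + a t • v) t := by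
  obtain ⟨p, hp, rfl, h⟩ := hasCurveDerivAt_iff_exists.1 (hasCurveDerivAt_iff_hasDerivAt.2 ha)
  obtain ⟨q, hq, rfl, h'⟩ := hasCurveDerivAt_iff_exists.1 hc
  refine hasCurveDerivAt_iff_exists.2
    ⟨fun δ => p δ • c t + a t • q δ + δ • (p δ • q δ), by fun_prop, by simp, fun δ => ?_⟩
  have h1 : a (t + δ) = a t + δ • p δ := by rw [← h]; ring
  have h2 : c (t + δ) = c t + δ • q δ := by rw [← h']; abel
  rw [h1, h2, smul_eq_mul]
  module

end CurveCalculus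

/-! ### Smooth curves and Hadamard's lemma -/

section SmoothCurve

variable {F : Type*} [AddCommGroup F] [Module ℝ F] [TopologicalSpace F]

/-- Coinduction for smoothness of curves. -/
theorem isSmoothCurve_of_forall_exists {P : (ℝ → F) → Prop}
    (hP : ∀ c, P c → ∃ c', P c' ∧ ∀ t, HasCurveDerivAt c (c' t) t) {c : ℝ → F} (hc : P c) :
    IsSmoothCurve c := by
  choose! D hD hD' using hP
  have h1 : ∀ n, P (D^[n] c) := fun n => by
    induction n with
    | zero => exact hc
    | succ n ih => rw [Function.iterate_succ_apply']; exact hD _ ih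
  refine ⟨fun n => D^[n] c, rfl, fun n t => ?_⟩
  simp only [Function.iterate_succ_apply']
  exact hD' _ (h1 n) t

theorem IsSmoothCurve.exists_deriv {c : ℝ → F} (hc : IsSmoothCurve c) :
    ∃ c', IsSmoothCurve c' ∧ ∀ t, HasCurveDerivAt c (c' t) t := by
  obtain ⟨d, rfl, hd⟩ := hc
  exact ⟨d 1, ⟨fun n => d (n + 1), rfl, fun n => hd _⟩, hd 0⟩

theorem isSmoothCurve_iff_contDiff {G : Type*} [NormedAddCommGroup G] [NormedSpace ℝ G]
    {c : ℝ → G} : IsSmoothCurve c ↔ ContDiff ℝ ∞ c := by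
  constructor
  · intro hc
    refine contDiff_infty.2 fun n => ?_
    induction n generalizing c with
    | zero =>
      obtain ⟨c', -, h⟩ := hc.exists_deriv
      refine contDiff_zero.2 (continuous_iff_continuousAt.2 fun t => ?_)
      exact (hasCurveDerivAt_iff_hasDerivAt.1 (h t)).continuousAt
    | succ n ih =>
      obtain ⟨c', hc', h⟩ := hc.exists_deriv
      have h' := fun t => hasCurveDerivAt_iff_hasDerivAt.1 (h t)
      push_cast
      refine contDiff_succ_iff_deriv.2 ⟨fun t => (h' t).differentiableAt, by simp, ?_⟩
      rw [show deriv c = c' from funext fun t => (h' t).deriv]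
      exact ih hc'
  · refine isSmoothCurve_of_forall_exists fun c hc => ?_
    obtain ⟨h1, h2⟩ := contDiff_infty_iff_deriv.1 hc
    exact ⟨deriv c, h2, fun t => hasCurveDerivAt_iff_hasDerivAt.2 (h1 t).hasDerivAt⟩

theorem isSmoothCurve_const (w : F) : IsSmoothCurve fun _ : ℝ => w :=
  isSmoothCurve_of_forall_exists (P := fun c => ∃ w : F, c = fun _ => w)
    (by rintro _ ⟨w, rfl⟩; exact ⟨fun _ => 0, ⟨0, rfl⟩, hasCurveDerivAt_const w⟩) ⟨w, rfl⟩

theorem IsSmoothCurve.prodMk {E : Type*} [AddCommGroup E] [Module ℝ E] [TopologicalSpace E]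
    {c : ℝ → E} {e : ℝ → F} (hc : IsSmoothCurve c) (he : IsSmoothCurve e) :
    IsSmoothCurve fun t => (c t, e t) := by
  obtain ⟨d, rfl, hd⟩ := hc
  obtain ⟨d', rfl, hd'⟩ := he
  exact ⟨fun n t => (d n t, d' n t), rfl, fun n t => (hd n t).prodMk (hd' n t)⟩

theorem IsSmoothCurve.clm_comp {E : Type*} [AddCommGroup E] [Module ℝ E] [TopologicalSpace E]
    {c : ℝ → E} (hc : IsSmoothCurve c) (L : E →L[ℝ] F) : IsSmoothCurve fun t => L (c t) := by
  obtain ⟨d, rfl, hd⟩ := hc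
  exact ⟨fun n t => L (d n t), rfl, fun n t => (hd n t).clm_comp L⟩

theorem IsSmoothCurve.fst {E : Type*} [AddCommGroup E] [Module ℝ E] [TopologicalSpace E]
    {c : ℝ → E × F} (hc : IsSmoothCurve c) : IsSmoothCurve fun t => (c t).1 :=
  hc.clm_comp (ContinuousLinearMap.fst ℝ E F)

theorem IsSmoothCurve.snd {E : Type*} [AddCommGroup E] [Module ℝ E] [TopologicalSpace E]
    {c : ℝ → E × F} (hc : IsSmoothCurve c) : IsSmoothCurve fun t => (c t).2 :=
  hc.clm_comp (ContinuousLinearMap.snd ℝ E F)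

variable [IsTopologicalAddGroup F]

theorem IsSmoothCurve.add {c e : ℝ → F} (hc : IsSmoothCurve c) (he : IsSmoothCurve e) :
    IsSmoothCurve fun t => c t + e t := by
  obtain ⟨d, rfl, hd⟩ := hc
  obtain ⟨d', rfl, hd'⟩ := he
  exact ⟨fun n t => d n t + d' n t, rfl, fun n t => (hd n t).add (hd' n t)⟩

variable [ContinuousSMul ℝ F]

theorem IsSmoothCurve.continuous {c : ℝ → F} (hc : IsSmoothCurve c) : Continuous c := by
  obtain ⟨c', -, h⟩ := hc.exists_deriv
  exact continuous_iff_continuousAt.2 fun t => (h t).continuousAt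

/-- For fixed `ρ`, the span of all curves `a • (c ∘ ρ)` is stable under differentiation, since the
derivative is `a' • (c ∘ ρ) + (a * ρ') • (c' ∘ ρ)`; coinduction applies to this span. -/
theorem IsSmoothCurve.smul_comp {a ρ : ℝ → ℝ} {c : ℝ → F} (hc : IsSmoothCurve c)
    (ha : ContDiff ℝ ∞ a) (hρ : ContDiff ℝ ∞ ρ) : IsSmoothCurve fun t => a t • c (ρ t) := by
  let S : Set (ℝ → F) := {f | ∃ (a : ℝ → ℝ) (c : ℝ → F), ContDiff ℝ ∞ a ∧ IsSmoothCurve c ∧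
    f = fun t => a t • c (ρ t)}
  refine isSmoothCurve_of_forall_exists (P := fun f => f ∈ Submodule.span ℝ S) ?_
    (Submodule.subset_span ⟨a, c, ha, hc, rfl⟩)
  intro f hf
  induction hf using Submodule.span_induction with
  | mem f hf =>
    obtain ⟨a, c, ha, hc, rfl⟩ := hf
    obtain ⟨c', hc', h⟩ := hc.exists_deriv
    obtain ⟨ha1, ha2⟩ := contDiff_infty_iff_deriv.1 ha
    obtain ⟨hρ1, hρ2⟩ := contDiff_infty_iff_deriv.1 hρ
    refine ⟨(fun t => deriv a t • c (ρ t)) + fun t => (a t * deriv ρ t) • c' (ρ t),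
      Submodule.add_mem _ (Submodule.subset_span ⟨_, _, ha2, hc, rfl⟩)
        (Submodule.subset_span ⟨_, _, ha.mul hρ2, hc', rfl⟩), fun t => ?_⟩
    simpa [mul_smul] using
      HasCurveDerivAt.smul (ha1 t).hasDerivAt ((h (ρ t)).comp (hρ1 t).hasDerivAt)
  | zero => exact ⟨0, Submodule.zero_mem _, hasCurveDerivAt_const 0⟩
  | add f g _ _ hf hg =>
    obtain ⟨f', hf', h⟩ := hf
    obtain ⟨g', hg', h'⟩ := hg
    exact ⟨f' + g', Submodule.add_mem _ hf' hg', fun t => (h t).add (h' t)⟩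
  | smul r f _ hf =>
    obtain ⟨f', hf', h⟩ := hf
    exact ⟨r • f', Submodule.smul_mem _ _ hf', fun t => by
      have := HasCurveDerivAt.smul (hasDerivAt_const t r) (h t)
      rwa [zero_smul, zero_add] at this⟩

theorem IsSmoothCurve.comp {ρ : ℝ → ℝ} {c : ℝ → F} (hc : IsSmoothCurve c)
    (hρ : ContDiff ℝ ∞ ρ) : IsSmoothCurve fun t => c (ρ t) := by
  simpa using hc.smul_comp (a := fun _ => 1) contDiff_const hρ

theorem IsSmoothCurve.smul {a : ℝ → ℝ} {c : ℝ → F} (hc : IsSmoothCurve c)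
    (ha : ContDiff ℝ ∞ a) : IsSmoothCurve fun t => a t • c t :=
  hc.smul_comp ha contDiff_id

theorem isSmoothCurve_smul_const {a : ℝ → ℝ} (ha : ContDiff ℝ ∞ a) (w : F) :
    IsSmoothCurve fun t => a t • w :=
  (isSmoothCurve_const w).smul ha

theorem isSmoothCurve_line (p v : F) : IsSmoothCurve fun t : ℝ => p + t • v :=
  (isSmoothCurve_const p).add (isSmoothCurve_smul_const contDiff_id v)

theorem hasCurveDerivAt_line (p v : F) (t : ℝ) : HasCurveDerivAt (fun t : ℝ => p + t • v) v t := by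
  simpa using (hasCurveDerivAt_const p t).add
    (HasCurveDerivAt.smul (hasDerivAt_id t) (hasCurveDerivAt_const v t))

variable [LocallyConvexSpace ℝ F]

/-- L'Hôpital's rule for curves in a locally convex space. -/
theorem tendsto_inv_pow_smul_of_hasCurveDerivAt {B r : ℝ → F} {w : F} {m : ℕ}
    (hB : ∀ t, HasCurveDerivAt B (t ^ m • r t) t) (hB0 : B 0 = 0)
    (hr : Tendsto r (𝓝[≠] 0) (𝓝 w)) :
    Tendsto (fun t : ℝ => (t ^ (m + 1))⁻¹ • B t) (𝓝[≠] 0) (𝓝 (((m : ℝ) + 1)⁻¹ • w)) := by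
  have hm : ((m : ℝ) + 1) ≠ 0 := by positivity
  refine ((LocallyConvexSpace.convex_basis (𝕜 := ℝ) (((m : ℝ) + 1)⁻¹ • w)).tendsto_right_iff).2 ?_
  rintro S ⟨hS, hSc⟩
  have h1 := (hr.const_smul ((m : ℝ) + 1)⁻¹).eventually (interior_mem_nhds.2 hS)
  obtain ⟨ε, hε, h1⟩ := Metric.mem_nhdsWithin_iff.1 h1
  refine Metric.mem_nhdsWithin_iff.2 ⟨ε, hε, ?_⟩
  rintro t ⟨htε, ht0 : t ≠ 0⟩
  change (t ^ (m + 1))⁻¹ • B t ∈ S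
  by_contra hcon
  -- If the quotient left the convex neighbourhood `S`, a functional `f` would separate it strictly
  -- from the interior. Cauchy's mean value theorem for `f ∘ B` against `t ^ (m + 1)` shows that `f`
  -- takes the same value at the quotient and at `r ξ / (m + 1)`, which is an interior point.
  obtain ⟨f, hf⟩ := geometric_hahn_banach_open_point hSc.interior isOpen_interior
    (fun h => hcon (interior_subset h))
  have hfB : ∀ t, HasDerivAt (fun t => f (B t)) (t ^ m * f (r t)) t := fun t => by
    simpa using hasCurveDerivAt_iff_hasDerivAt.1 ((hB t).clm_comp f)
  have hpow : ∀ t : ℝ, HasDerivAt (fun t : ℝ => t ^ (m + 1)) (((m : ℝ) + 1) * t ^ m) t := fun t => by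
    simpa using hasDerivAt_pow (m + 1) t
  have key : ∃ ξ : ℝ, |ξ| < |t| ∧ ξ ≠ 0 ∧
      t ^ (m + 1) * (ξ ^ m * f (r ξ)) = f (B t) * (((m : ℝ) + 1) * ξ ^ m) := by
    have hc1 : Continuous fun t => f (B t) :=
      continuous_iff_continuousAt.2 fun t => (hfB t).continuousAt
    have hc2 : Continuous fun t : ℝ => t ^ (m + 1) := by fun_prop
    rcases ht0.lt_or_gt with ht | ht
    · obtain ⟨ξ, hξ, h⟩ := exists_ratio_hasDerivAt_eq_ratio_slope _ _ ht hc1.continuousOn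
        (fun x _ => hfB x) _ _ hc2.continuousOn (fun x _ => hpow x)
      refine ⟨ξ, by
        rw [abs_of_neg hξ.2, abs_of_neg ht]; exact neg_lt_neg hξ.1, hξ.2.ne, ?_⟩
      simp only [hB0, map_zero] at h
      rw [zero_pow (by omega)] at h
      linarith
    · obtain ⟨ξ, hξ, h⟩ := exists_ratio_hasDerivAt_eq_ratio_slope _ _ ht hc1.continuousOn
        (fun x _ => hfB x) _ _ hc2.continuousOn (fun x _ => hpow x)
      refine ⟨ξ, by
        rw [abs_of_pos hξ.1, abs_of_pos ht]; exact hξ.2, hξ.1.ne', ?_⟩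
      simp only [hB0, map_zero] at h
      rw [zero_pow (by omega)] at h
      linarith
  obtain ⟨ξ, hξt, hξ0, hξ⟩ := key
  have h2 : ((m : ℝ) + 1)⁻¹ • r ξ ∈ interior S :=
    h1 ⟨by simpa using hξt.trans (by simpa using htε), hξ0⟩
  refine absurd (hf _ h2) (not_lt.2 (le_of_eq ?_))
  have h3 : ξ ^ m ≠ 0 := pow_ne_zero _ hξ0
  have h4 : t ^ (m + 1) ≠ 0 := pow_ne_zero _ ht0
  simp only [map_smul, smul_eq_mul]
  rw [inv_mul_eq_div, inv_mul_eq_div, div_eq_div_iff h4 hm]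
  refine mul_right_cancel₀ h3 ?_
  linarith

/-- Hadamard's lemma for curves. -/
theorem IsSmoothCurve.exists_slope {c : ℝ → F} (hc : IsSmoothCurve c) :
    ∃ e : ℝ → F, IsSmoothCurve e ∧ ∀ t, c t = c 0 + t • e t := by
  obtain ⟨d, rfl, hd⟩ := hc
  -- Away from `0`, the `n`-th derivative of `(c t - c 0) / t` is `A n t / t ^ (n + 1)`: the
  -- recursion is the quotient rule, using `(A n)' = t ^ n • d (n + 1)`.
  let A : ℕ → ℝ → F := fun n => Nat.rec (fun t => d 0 t - d 0 0)
    (fun n An t => t ^ (n + 1) • d (n + 1) t - ((n : ℝ) + 1) • An t) n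
  have hAs : ∀ n t, A (n + 1) t = t ^ (n + 1) • d (n + 1) t + (-((n : ℝ) + 1)) • A n t :=
    fun n t => by rw [neg_smul, ← sub_eq_add_neg]
  have hA0 : ∀ n, A n 0 = 0 := fun n => by
    induction n with
    | zero => simp [A]
    | succ n ih => rw [hAs, ih]; simp
  have hA : ∀ n t, HasCurveDerivAt (A n) (t ^ n • d (n + 1) t) t := fun n => by
    induction n with
    | zero =>
      intro t
      simpa [A, sub_eq_add_neg] using (hd 0 t).add (hasCurveDerivAt_const (-d 0 0) t)
    | succ n ih =>
      intro t
      have h1 := (HasCurveDerivAt.smul (hasDerivAt_pow (n + 1) t) (hd (n + 1) t)).add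
        (HasCurveDerivAt.smul (hasDerivAt_const t (-((n : ℝ) + 1))) (ih t))
      rw [show A (n + 1) = _ from funext (hAs n)]
      convert h1 using 1
      simp only [Nat.add_sub_cancel]
      push_cast
      module
  let e : ℕ → ℝ → F := fun n t =>
    if t = 0 then ((n : ℝ) + 1)⁻¹ • d (n + 1) 0 else (t ^ (n + 1))⁻¹ • A n t
  have he : ∀ n t, t ≠ 0 → e n t = (t ^ (n + 1))⁻¹ • A n t := fun n t ht => if_neg ht
  have he0 : ∀ n : ℕ, e n 0 = ((n : ℝ) + 1)⁻¹ • d (n + 1) 0 := fun n => if_pos rfl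
  refine ⟨e 0, ⟨e, rfl, fun n t => ?_⟩, fun t => ?_⟩
  · rcases eq_or_ne t 0 with rfl | ht
    · let B : ℝ → F := fun t => A n t + t ^ (n + 1) • (-((n : ℝ) + 1)⁻¹ • d (n + 1) 0)
      have hB : ∀ t, HasCurveDerivAt B (t ^ (n + 1) • (t⁻¹ • (d (n + 1) (0 + t) - d (n + 1) 0))) t := by
        intro t
        have h1 := (hA n t).add (HasCurveDerivAt.smul (hasDerivAt_pow (n + 1) t)
          (hasCurveDerivAt_const (-((n : ℝ) + 1)⁻¹ • d (n + 1) 0) t))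
        convert h1 using 1
        have hn : ((n : ℝ) + 1) ≠ 0 := by positivity
        rcases eq_or_ne t 0 with rfl | ht
        · rcases n with _ | n <;> simp
        · rw [smul_smul, pow_succ, mul_assoc, mul_inv_cancel₀ ht, mul_one, zero_add, smul_zero,
            add_zero, smul_smul]
          simp only [Nat.add_sub_cancel]
          push_cast
          rw [show ((n : ℝ) + 1) * t ^ n * -((n : ℝ) + 1)⁻¹ = -t ^ n by field_simp]
          module
      have h2 := tendsto_inv_pow_smul_of_hasCurveDerivAt hB (by simp [B, hA0]) (hd (n + 1) 0)
      rw [he0]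
      push_cast at h2 ⊢
      refine Tendsto.congr' ?_ h2
      filter_upwards [self_mem_nhdsWithin] with δ (hδ : δ ≠ 0)
      rw [zero_add, he _ _ hδ, he0]
      have h3 : δ ^ (n + 1) ≠ 0 := pow_ne_zero _ hδ
      simp only [B, smul_add, smul_sub, smul_smul]
      rw [pow_succ δ (n + 1), mul_inv, mul_comm (δ ^ (n + 1))⁻¹, sub_eq_add_neg, ← neg_smul]
      congr 2
      field_simp
    · rw [he _ _ ht]
      have h1 : e n =ᶠ[𝓝 t] fun t => (t ^ (n + 1))⁻¹ • A n t := by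
        filter_upwards [isOpen_ne.mem_nhds ht] with s hs using he _ _ hs
      refine HasCurveDerivAt.congr_of_eventuallyEq ?_ h1
      have h3 : t ^ (n + 1) ≠ 0 := pow_ne_zero _ ht
      convert HasCurveDerivAt.smul ((hasDerivAt_pow (n + 1) t).fun_inv h3) (hA n t) using 1
      rw [hAs, smul_add, smul_smul, smul_smul, smul_smul, add_comm]
      simp only [Nat.add_sub_cancel]
      push_cast
      congr 2 <;> field_simp <;> ring
  · rcases eq_or_ne t 0 with rfl | ht
    · simp
    · rw [he _ _ ht]
      simp [A, smul_smul, mul_inv_cancel₀ ht]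

end SmoothCurve

/-! ### Differential calculus of smooth maps: linearity, symmetry, chain rule -/

section SmoothMaps

/-- Serves to localize: reparametrizing by `ρ` keeps a curve inside an open set it occupies only for
small times, without changing its germ at `0`. -/
theorem exists_contDiff_abs_lt {ε : ℝ} (hε : 0 < ε) :
    ∃ ρ : ℝ → ℝ, ContDiff ℝ ∞ ρ ∧ (∀ᶠ t in 𝓝 0, ρ t = t) ∧ ∀ t, |ρ t| < ε := by
  let φ : ContDiffBump (0 : ℝ) := ⟨ε / 4, ε / 2, by positivity, by linarith⟩
  refine ⟨fun t => φ t * t, φ.contDiff.mul contDiff_id, ?_, fun t => ?_⟩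
  · filter_upwards [φ.eventuallyEq_one] with t ht
    simp [ht]
  · rcases lt_or_ge |t| ε with h | h
    · change |φ t * t| < ε
      rw [abs_mul, abs_of_nonneg φ.nonneg]
      exact (mul_le_of_le_one_left (abs_nonneg _) φ.le_one).trans_lt h
    · change |φ t * t| < ε
      rw [φ.zero_of_le_dist, zero_mul, abs_zero]
      · exact hε
      · simp only [dist_zero_right, Real.norm_eq_abs]
        change ε / 2 ≤ |t|
        linarith

variable {E : Type*} [AddCommGroup E] [Module ℝ E] [TopologicalSpace E]
variable {F : Type*} [AddCommGroup F] [Module ℝ F] [TopologicalSpace F]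
variable {U : Set E}

theorem IsSmoothOn.comp {G : Type*} [AddCommGroup G] [Module ℝ G] [TopologicalSpace G]
    {f : E → F} {V : Set F} {g : F → G} (hg : IsSmoothOn g V) (hf : IsSmoothOn f U)
    (h : MapsTo f U V) : IsSmoothOn (fun p => g (f p)) U :=
  fun c hc hcU => hg _ (hf c hc hcU) fun t => h (hcU t)

theorem IsSmoothOn.clm_comp {G : Type*} [AddCommGroup G] [Module ℝ G] [TopologicalSpace G]
    {f : E → F} (hf : IsSmoothOn f U) (L : F →L[ℝ] G) : IsSmoothOn (fun p => L (f p)) U :=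
  fun c hc hcU => (hf c hc hcU).clm_comp L

theorem HasCurveDerivAt.dirDeriv_eq [T2Space F] {E : Type*} [AddCommGroup E] [Module ℝ E]
    {f : E → F} {p v : E} {w : F}
    (h : HasCurveDerivAt (fun t : ℝ => f (p + t • v)) w 0) : dirDeriv f p v = w :=
  h.curveDeriv_eq

variable [IsTopologicalAddGroup E] [ContinuousSMul ℝ E]

theorem IsSmoothOn.exists_hasCurveDerivAt {f : E → F} (hf : IsSmoothOn f U) (hU : IsOpen U)
    {c : ℝ → E} (hc : IsSmoothCurve c) {t₀ : ℝ} (ht₀ : c t₀ ∈ U) :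
    ∃ w, HasCurveDerivAt (fun t => f (c t)) w t₀ := by
  have h1 : Continuous fun τ => c (t₀ + τ) := hc.continuous.comp (by fun_prop)
  obtain ⟨ε, hε, h2⟩ := Metric.mem_nhds_iff.1
    (h1.continuousAt.preimage_mem_nhds (hU.mem_nhds (by simpa using ht₀)) : _ ∈ 𝓝 (0 : ℝ))
  obtain ⟨ρ, hρ, hρ0, hρε⟩ := exists_contDiff_abs_lt hε
  obtain ⟨c', -, h3⟩ := (hf (fun τ => c (t₀ + ρ τ)) (hc.comp (contDiff_const.add hρ))
    fun t => h2 (by simpa using hρε t)).exists_deriv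
  refine ⟨c' 0, ?_⟩
  have h4 : HasCurveDerivAt (fun τ => f (c (t₀ + τ))) (c' 0) 0 := by
    refine (h3 0).congr_of_eventuallyEq ?_
    filter_upwards [hρ0] with t ht
    rw [ht]
  simpa using (hasCurveDerivAt_comp_const_add (c := fun t => f (c t))).1 h4

/-- The gateway to classical calculus: after cutting off both variables by `ρ`, the function maps
smooth plane curves to smooth curves, so Boman's theorem applies. -/
theorem IsSmoothOn.contDiffAt {g : E → ℝ} (hg : IsSmoothOn g U) (hU : IsOpen U)
    {p u : ℝ → E} (hp : IsSmoothCurve p) (hu : IsSmoothCurve u) {s₀ t₀ : ℝ}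
    (h₀ : p t₀ + s₀ • u t₀ ∈ U) :
    ContDiffAt ℝ ∞ (fun q : ℝ × ℝ => g (p q.2 + q.1 • u q.2)) (s₀, t₀) := by
  have hpc := hp.continuous
  have huc := hu.continuous
  have h1 : Continuous fun q : ℝ × ℝ => p (t₀ + q.2) + (s₀ + q.1) • u (t₀ + q.2) := by fun_prop
  obtain ⟨ε, hε, h2⟩ := Metric.mem_nhds_iff.1
    (h1.continuousAt.preimage_mem_nhds (hU.mem_nhds (by simpa using h₀)) : _ ∈ 𝓝 (0 : ℝ × ℝ))
  obtain ⟨ρ, hρ, hρ0, hρε⟩ := exists_contDiff_abs_lt hε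
  have h3 : CurveSmooth fun q : ℝ × ℝ =>
      g (p (t₀ + ρ q.2) + (s₀ + ρ q.1) • u (t₀ + ρ q.2)) := fun c hc => by
    have hc1 := hρ.comp (contDiff_fst.comp hc)
    have hc2 := hρ.comp (contDiff_snd.comp hc)
    refine isSmoothCurve_iff_contDiff.1 (hg (fun t =>
      p (t₀ + ρ (c t).2) + (s₀ + ρ (c t).1) • u (t₀ + ρ (c t).2)) ?_ fun t => ?_)
    · exact (hp.comp (contDiff_const.add hc2)).add
        (hu.smul_comp (contDiff_const.add hc1) (contDiff_const.add hc2))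
    · refine h2 (a := (ρ (c t).1, ρ (c t).2)) ?_
      simpa [Prod.norm_def] using ⟨hρε (c t).1, hρε (c t).2⟩
  have h4 : ContDiff ℝ ∞ fun q : ℝ × ℝ => (q.1 - s₀, q.2 - t₀) := by fun_prop
  refine ((h3.contDiff.comp h4).contDiffAt (x := (s₀, t₀))).congr_of_eventuallyEq ?_
  have h5 : Tendsto (fun q : ℝ × ℝ => q.1 - s₀) (𝓝 (s₀, t₀)) (𝓝 0) := by
    have : Continuous fun q : ℝ × ℝ => q.1 - s₀ := by fun_prop
    simpa using this.tendsto (s₀, t₀)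
  have h6 : Tendsto (fun q : ℝ × ℝ => q.2 - t₀) (𝓝 (s₀, t₀)) (𝓝 0) := by
    have : Continuous fun q : ℝ × ℝ => q.2 - t₀ := by fun_prop
    simpa using this.tendsto (s₀, t₀)
  filter_upwards [h5.eventually hρ0, h6.eventually hρ0] with q hq1 hq2
  simp [hq1, hq2]

theorem IsSmoothOn.hasCurveDerivAt_line [T2Space F] {f : E → F} (hf : IsSmoothOn f U)
    (hU : IsOpen U) {p : E} (hp : p ∈ U) (v : E) :
    HasCurveDerivAt (fun t : ℝ => f (p + t • v)) (dirDeriv f p v) 0 := by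
  obtain ⟨w, hw⟩ := hf.exists_hasCurveDerivAt hU (isSmoothCurve_line p v) (t₀ := 0) (by simpa)
  rwa [hw.dirDeriv_eq]

theorem IsSmoothOn.dirDeriv_smul [T2Space F] [ContinuousSMul ℝ F] {f : E → F}
    (hf : IsSmoothOn f U) (hU : IsOpen U) {p : E} (hp : p ∈ U) (a : ℝ) (v : E) :
    dirDeriv f p (a • v) = a • dirDeriv f p v := by
  refine HasCurveDerivAt.dirDeriv_eq ?_
  have h1 : HasDerivAt (fun t : ℝ => t * a) a 0 := by simpa using (hasDerivAt_id (0 : ℝ)).mul_const a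
  have := HasCurveDerivAt.comp (a := fun t : ℝ => t * a) (t := 0)
    (by simpa using hf.hasCurveDerivAt_line hU hp v) h1
  simpa [smul_smul] using this

theorem dirDeriv_clm_comp {G : Type*} [AddCommGroup G] [Module ℝ G] [TopologicalSpace G]
    [T2Space F] [T2Space G] {f : E → F} (hf : IsSmoothOn f U) (hU : IsOpen U) {p : E} (hp : p ∈ U)
    (v : E) (L : F →L[ℝ] G) : dirDeriv (fun p => L (f p)) p v = L (dirDeriv f p v) :=
  HasCurveDerivAt.dirDeriv_eq ((hf.hasCurveDerivAt_line hU hp v).clm_comp L)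

theorem IsSmoothOn.dirDeriv_eq_fderiv {g : E → ℝ} (hg : IsSmoothOn g U) (hU : IsOpen U)
    {p u : ℝ → E} (hp : IsSmoothCurve p) (hu : IsSmoothCurve u) {s₀ t₀ : ℝ}
    (h₀ : p t₀ + s₀ • u t₀ ∈ U) :
    dirDeriv g (p t₀ + s₀ • u t₀) (u t₀)
      = fderiv ℝ (fun q : ℝ × ℝ => g (p q.2 + q.1 • u q.2)) (s₀, t₀) (1, 0) := by
  refine HasCurveDerivAt.dirDeriv_eq (hasCurveDerivAt_iff_hasDerivAt.2 ?_)
  have h1 := ((hg.contDiffAt hU hp hu h₀).differentiableAt (by simp)).hasFDerivAt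
  have h2 : HasDerivAt (fun s : ℝ => ((s₀ + s, t₀) : ℝ × ℝ)) (1, 0) 0 :=
    ((hasDerivAt_id (0 : ℝ)).const_add s₀).prodMk (hasDerivAt_const _ _)
  have h3 := HasFDerivAt.comp_hasDerivAt (x := (0 : ℝ)) (f := fun s : ℝ => ((s₀ + s, t₀) : ℝ × ℝ))
    (l := fun q : ℝ × ℝ => g (p q.2 + q.1 • u q.2)) (by simpa using h1) h2
  simpa [Function.comp_def, add_smul, add_assoc] using h3

theorem IsSmoothOn.dirDeriv_eq_fderiv_plane {g : E → ℝ} (hg : IsSmoothOn g U) (hU : IsOpen U)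
    {p u v : E} {s₀ t₀ : ℝ} (h₀ : p + t₀ • v + s₀ • u ∈ U) (a b : ℝ) :
    dirDeriv g (p + t₀ • v + s₀ • u) (a • u + b • v)
      = fderiv ℝ (fun q : ℝ × ℝ => g (p + q.2 • v + q.1 • u)) (s₀, t₀) (a, b) := by
  refine HasCurveDerivAt.dirDeriv_eq (hasCurveDerivAt_iff_hasDerivAt.2 ?_)
  have h1 := ((hg.contDiffAt hU (isSmoothCurve_line p v) (isSmoothCurve_const u)
    h₀).differentiableAt (by simp)).hasFDerivAt
  have h2 : HasDerivAt (fun s : ℝ => ((s₀ + s * a, t₀ + s * b) : ℝ × ℝ)) (a, b) 0 := by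
    simpa using (((hasDerivAt_id (0 : ℝ)).mul_const a).const_add s₀).prodMk
      (((hasDerivAt_id (0 : ℝ)).mul_const b).const_add t₀)
  have h3 := HasFDerivAt.comp_hasDerivAt (x := (0 : ℝ))
    (f := fun s : ℝ => ((s₀ + s * a, t₀ + s * b) : ℝ × ℝ))
    (l := fun q : ℝ × ℝ => g (p + q.2 • v + q.1 • u)) (by simpa using h1) h2
  refine h3.congr_of_eventuallyEq (Eventually.of_forall fun t => ?_)
  simp only [Function.comp_def]
  congr 1
  module

theorem IsSmoothOn.dirDeriv_add_real {g : E → ℝ} (hg : IsSmoothOn g U) (hU : IsOpen U)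
    {p : E} (hp : p ∈ U) (v w : E) :
    dirDeriv g p (v + w) = dirDeriv g p v + dirDeriv g p w := by
  have key := hg.dirDeriv_eq_fderiv_plane hU (p := p) (u := v) (v := w) (s₀ := 0) (t₀ := 0)
    (by simpa)
  have h1 := key 1 1
  have h2 := key 1 0
  have h3 := key 0 1
  simp only [zero_smul, one_smul, add_zero, zero_add] at h1 h2 h3
  rw [h1, h2, h3, ← map_add]
  simp

/-- Write `c (t₀ + t) = c t₀ + t • e t` with `e 0 = v`. Then `g (c (t₀ + t)) = H(t, t)` for the
smooth function `H(s, t) = g (c t₀ + s • e t)`. As `H(0, ·)` is constant, only `∂ₛH(0, 0)` survives,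
and it is the directional derivative along `v`. -/
theorem IsSmoothOn.hasDerivAt_comp_curve [LocallyConvexSpace ℝ E] {g : E → ℝ}
    (hg : IsSmoothOn g U) (hU : IsOpen U) [T2Space E] {c : ℝ → E} (hc : IsSmoothCurve c)
    {v : E} {t₀ : ℝ} (hv : HasCurveDerivAt c v t₀) (ht₀ : c t₀ ∈ U) :
    HasDerivAt (fun t => g (c t)) (dirDeriv g (c t₀) v) t₀ := by
  obtain ⟨e, he, hce⟩ := (hc.comp (ρ := fun t => t₀ + t) (by fun_prop)).exists_slope
  simp only [add_zero] at hce
  have hev : e 0 = v := by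
    have h1 : HasCurveDerivAt (fun t => c (t₀ + t)) v 0 :=
      hasCurveDerivAt_comp_const_add.2 (by simpa using hv)
    refine HasCurveDerivAt.unique (hasCurveDerivAt_iff_exists.2
      ⟨e, he.continuous.continuousAt, rfl, fun δ => ?_⟩) h1
    simp [hce]
  have hp := isSmoothCurve_const (c t₀)
  have h1 := ((hg.contDiffAt hU hp he (s₀ := 0) (t₀ := 0)
    (by simpa)).differentiableAt (by simp)).hasFDerivAt
  have h2 := hg.dirDeriv_eq_fderiv hU hp he (s₀ := 0) (t₀ := 0) (by simpa)
  have h3 : fderiv ℝ (fun q : ℝ × ℝ => g (c t₀ + q.1 • e q.2)) (0, 0) (0, 1) = 0 := by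
    have := HasFDerivAt.comp_hasDerivAt (x := (0 : ℝ)) (f := fun s : ℝ => ((0, s) : ℝ × ℝ))
      (l := fun q : ℝ × ℝ => g (c t₀ + q.1 • e q.2)) h1
      ((hasDerivAt_const _ _).prodMk (hasDerivAt_id _))
    refine this.unique ?_
    simpa [Function.comp_def] using hasDerivAt_const (0 : ℝ) (g (c t₀))
  have h4 : HasDerivAt (fun t => g (c (t₀ + t)))
      (fderiv ℝ (fun q : ℝ × ℝ => g (c t₀ + q.1 • e q.2)) (0, 0) (1, 1)) 0 := by
    have := HasFDerivAt.comp_hasDerivAt (x := (0 : ℝ)) (f := fun s : ℝ => ((s, s) : ℝ × ℝ))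
      (l := fun q : ℝ × ℝ => g (c t₀ + q.1 • e q.2)) h1
      ((hasDerivAt_id _).prodMk (hasDerivAt_id _))
    simpa only [Function.comp_def, ← hce] using this
  have h5 : ((1, 1) : ℝ × ℝ) = (1, 0) + (0, 1) := by simp
  rw [h5, map_add, h3, add_zero, ← h2, zero_smul, add_zero, hev] at h4
  have h6 := (hasCurveDerivAt_comp_const_add (c := fun t => g (c t))).1
    (hasCurveDerivAt_iff_hasDerivAt.2 h4)
  exact hasCurveDerivAt_iff_hasDerivAt.1 (by simpa using h6)

/-- Along a curve `(p, u)` the directional derivative is `∂ₛ` at `s = 0` of `g (p t + s • u t)`,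
hence smooth in `t`. -/
theorem IsSmoothOn.dirDeriv_prod {g : E → ℝ} (hg : IsSmoothOn g U) (hU : IsOpen U) :
    IsSmoothOn (fun q : E × E => dirDeriv g q.1 q.2) (U ×ˢ (univ : Set E)) := by
  intro c hc hcU
  let H : ℝ × ℝ → ℝ := fun q => g ((c q.2).1 + q.1 • (c q.2).2)
  have h0 : ∀ t, (c t).1 + (0 : ℝ) • (c t).2 ∈ U := fun t => by simpa using (hcU t).1
  have h1 : (fun t => dirDeriv g (c t).1 (c t).2) = fun t => fderiv ℝ H (0, t) (1, 0) := by
    ext t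
    have h5 := hg.dirDeriv_eq_fderiv hU hc.fst hc.snd (h0 t)
    rwa [zero_smul, add_zero] at h5
  have h2 : ∀ t₀, ContDiffAt ℝ ∞ H (0, t₀) := fun t₀ => hg.contDiffAt hU hc.fst hc.snd (h0 t₀)
  clear_value H
  refine isSmoothCurve_iff_contDiff.2 (h1 ▸ contDiff_iff_contDiffAt.2 fun t₀ => ?_)
  have h3 : ContDiffAt ℝ ∞ (fun t : ℝ => ((0, t) : ℝ × ℝ)) t₀ := by fun_prop
  have h4 : ContDiffAt ℝ ∞ (fun t : ℝ => fderiv ℝ H (0, t)) t₀ :=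
    ContDiffAt.comp (g := fderiv ℝ H) t₀ ((h2 t₀).fderiv_right (m := ∞) (by simp)) h3
  exact h4.clm_apply contDiffAt_const

theorem IsSmoothOn.dirDeriv_right {g : E → ℝ} (hg : IsSmoothOn g U) (hU : IsOpen U) (u : E) :
    IsSmoothOn (fun p => dirDeriv g p u) U :=
  fun c hc hcU => hg.dirDeriv_prod hU (fun t => (c t, u)) (hc.prodMk (isSmoothCurve_const u))
    fun t => ⟨hcU t, mem_univ _⟩

/-- Second derivatives are symmetric. -/
theorem IsSmoothOn.dirDeriv_comm {g : E → ℝ} (hg : IsSmoothOn g U) (hU : IsOpen U) {p : E}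
    (hp : p ∈ U) (u v : E) :
    dirDeriv (fun p => dirDeriv g p u) p v = dirDeriv (fun p => dirDeriv g p v) p u := by
  let H : ℝ × ℝ → ℝ := fun q => g (p + q.2 • v + q.1 • u)
  have h1 : ContDiffAt ℝ ∞ H (0, 0) :=
    hg.contDiffAt hU (isSmoothCurve_line p v) (isSmoothCurve_const u) (by simpa)
  have h2 := ((h1.fderiv_right (m := ∞) (by simp)).differentiableAt (by simp)).hasFDerivAt
  -- Both derivatives lie in the plane through `p` spanned by `u` and `v`, so they are entries of
  -- the second derivative of `H`.
  have key : ∀ a b a' b' : ℝ, dirDeriv (fun p => dirDeriv g p (a • u + b • v)) p (a' • u + b' • v)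
      = fderiv ℝ (fderiv ℝ H) (0, 0) (a', b') (a, b) := by
    intro a b a' b'
    have h3 : HasDerivAt (fun s : ℝ => ((s * a', s * b') : ℝ × ℝ)) (a', b') 0 := by
      simpa using ((hasDerivAt_id (0 : ℝ)).mul_const a').prodMk
        ((hasDerivAt_id (0 : ℝ)).mul_const b')
    have h4 : HasDerivAt (fun s : ℝ => fderiv ℝ H (s * a', s * b') (a, b))
        (fderiv ℝ (fderiv ℝ H) (0, 0) (a', b') (a, b)) 0 := by
      have h5 := HasFDerivAt.comp_hasDerivAt (x := (0 : ℝ))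
        (f := fun s : ℝ => ((s * a', s * b') : ℝ × ℝ)) (l := fderiv ℝ H) (by simpa using h2) h3
      simpa [Function.comp_def] using h5.clm_apply (hasDerivAt_const 0 ((a, b) : ℝ × ℝ))
    refine HasCurveDerivAt.dirDeriv_eq
      ((hasCurveDerivAt_iff_hasDerivAt.2 h4).congr_of_eventuallyEq ?_)
    have h6 : ∀ᶠ s : ℝ in 𝓝 0, p + s • (a' • u + b' • v) ∈ U :=
      (isSmoothCurve_line p _).continuous.continuousAt.preimage_mem_nhds (hU.mem_nhds (by simpa))
    filter_upwards [h6] with s hs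
    have h7 : p + s • (a' • u + b' • v) = p + (s * b') • v + (s * a') • u := by module
    rw [h7] at hs ⊢
    exact hg.dirDeriv_eq_fderiv_plane hU hs a b
  have hsymm := (h1.isSymmSndFDerivAt (by
    simpa using (show ((2 : ℕ∞) : WithTop ℕ∞) ≤ ∞ from WithTop.coe_le_coe.2 le_top))).eq (0, 1) (1, 0)
  have k1 := key 1 0 0 1
  have k2 := key 0 1 1 0
  simp only [zero_smul, one_smul, add_zero, zero_add] at k1 k2
  rw [k1, k2, hsymm]

variable [IsTopologicalAddGroup F] [ContinuousSMul ℝ F] [LocallyConvexSpace ℝ F] [T2Space F]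

theorem IsSmoothOn.dirDeriv_add {f : E → F} (hf : IsSmoothOn f U) (hU : IsOpen U)
    {p : E} (hp : p ∈ U) (v w : E) :
    dirDeriv f p (v + w) = dirDeriv f p v + dirDeriv f p w := by
  refine (SeparatingDual.eq_iff_forall_dual_eq (R := ℝ)).2 fun L => ?_
  rw [map_add, ← dirDeriv_clm_comp hf hU hp, ← dirDeriv_clm_comp hf hU hp,
    ← dirDeriv_clm_comp hf hU hp, (hf.clm_comp L).dirDeriv_add_real hU hp]

variable [LocallyConvexSpace ℝ E] [T2Space E]

/-- The chain rule. -/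
theorem IsSmoothOn.hasCurveDerivAt_comp {f : E → F} (hf : IsSmoothOn f U) (hU : IsOpen U)
    {c : ℝ → E} (hc : IsSmoothCurve c) {v : E} {t₀ : ℝ} (hv : HasCurveDerivAt c v t₀)
    (ht₀ : c t₀ ∈ U) : HasCurveDerivAt (fun t => f (c t)) (dirDeriv f (c t₀) v) t₀ := by
  obtain ⟨w, hw⟩ := hf.exists_hasCurveDerivAt hU hc ht₀
  suffices h : dirDeriv f (c t₀) v = w by rwa [h]
  refine (SeparatingDual.eq_iff_forall_dual_eq (R := ℝ)).2 fun L => ?_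
  rw [← dirDeriv_clm_comp hf hU ht₀]
  exact ((hf.clm_comp L).hasDerivAt_comp_curve hU hc hv ht₀).unique
    (hasCurveDerivAt_iff_hasDerivAt.1 (hw.clm_comp L))

end SmoothMaps

/-! ### 1-forms on open subsets of the model space -/

section LocalForms

variable {E : Type*} [AddCommGroup E] [Module ℝ E] [TopologicalSpace E]
variable {U : Set E}

theorem isSmoothOn_const {F : Type*} [AddCommGroup F] [Module ℝ F] [TopologicalSpace F] (w : F) :
    IsSmoothOn (fun _ : E => w) U :=
  fun _ _ _ => isSmoothCurve_const w

theorem isSmoothOn_id : IsSmoothOn (fun p : E => p) U :=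
  fun _ hc _ => hc

theorem IsSmoothOn.prodMk {F G : Type*} [AddCommGroup F] [Module ℝ F] [TopologicalSpace F]
    [AddCommGroup G] [Module ℝ G] [TopologicalSpace G] {f : E → F} {g : E → G}
    (hf : IsSmoothOn f U) (hg : IsSmoothOn g U) : IsSmoothOn (fun p => (f p, g p)) U :=
  fun c hc hcU => (hf c hc hcU).prodMk (hg c hc hcU)

theorem isSmoothOn_add {f g : E → ℝ} (hf : IsSmoothOn f U) (hg : IsSmoothOn g U) :
    IsSmoothOn (fun p => f p + g p) U :=
  fun c hc hcU => (hf c hc hcU).add (hg c hc hcU)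

theorem isSmoothOn_const_mul {f : E → ℝ} (hf : IsSmoothOn f U) (a : ℝ) :
    IsSmoothOn (fun p => a * f p) U :=
  fun c hc hcU => (hf c hc hcU).smul (a := fun _ => a) contDiff_const

theorem isSmoothOn_sub {f g : E → ℝ} (hf : IsSmoothOn f U) (hg : IsSmoothOn g U) :
    IsSmoothOn (fun p => f p - g p) U := by
  simpa [sub_eq_add_neg] using isSmoothOn_add hf (isSmoothOn_const_mul hg (-1))

/-- `A` is a smooth 1-form on the open subset `U` of a locally convex space. -/
structure IsLocalForm (A : E → E → ℝ) (U : Set E) : Prop where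
  isOpen : IsOpen U
  smooth : IsSmoothOn (fun q : E × E => A q.1 q.2) (U ×ˢ (univ : Set E))
  add : ∀ p ∈ U, ∀ u v, A p (u + v) = A p u + A p v
  smul : ∀ p ∈ U, ∀ (a : ℝ) u, A p (a • u) = a * A p u

/-- The exterior derivative of the 1-form `A` on an open subset of `E`. -/
noncomputable def localExtDeriv (A : E → E → ℝ) (p u w : E) : ℝ :=
  dirDeriv (fun p => A p w) p u - dirDeriv (fun p => A p u) p w

theorem localExtDeriv_swap {E : Type*} [AddCommGroup E] [Module ℝ E] 
    (A : E → E → ℝ) (p u w : E) :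
    localExtDeriv A p u w = -localExtDeriv A p w u := by
  simp [localExtDeriv]

namespace IsLocalForm

variable {A : E → E → ℝ}

theorem smooth_left (hA : IsLocalForm A U) (w : E) : IsSmoothOn (fun p => A p w) U :=
  fun c hc hcU => hA.smooth (fun t => (c t, w)) (hc.prodMk (isSmoothCurve_const w))
    fun t => ⟨hcU t, mem_univ _⟩

theorem smooth_right (hA : IsLocalForm A U) {p : E} (hp : p ∈ U) : IsSmoothOn (A p) univ :=
  fun c hc _ => hA.smooth (fun t => (p, c t)) ((isSmoothCurve_const p).prodMk hc)
    fun _ => ⟨hp, mem_univ _⟩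

theorem mono (hA : IsLocalForm A U) {V : Set E} (hV : IsOpen V) (h : V ⊆ U) : IsLocalForm A V :=
  ⟨hV, fun c hc hcV => hA.smooth c hc fun t => ⟨h (hcV t).1, mem_univ _⟩,
    fun p hp => hA.add p (h hp), fun p hp => hA.smul p (h hp)⟩

theorem dirDeriv_apply (hA : IsLocalForm A U) {p : E} (hp : p ∈ U) (u w : E) :
    dirDeriv (A p) u w = A p w := by
  refine HasCurveDerivAt.dirDeriv_eq (hasCurveDerivAt_iff_hasDerivAt.2 ?_)
  have h1 : (fun t : ℝ => A p (u + t • w)) = fun t => A p u + t * A p w := by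
    ext t
    rw [hA.add p hp, hA.smul p hp]
  rw [h1]
  simpa using ((hasDerivAt_id (0 : ℝ)).mul_const (A p w)).const_add (A p u)

theorem dirDeriv_left {E : Type*} [AddCommGroup E] [Module ℝ E] 
    {A : E → E → ℝ} (w p u : E) : dirDeriv (fun p => A p w) p u
    = dirDeriv (fun q : E × E => A q.1 q.2) (p, w) (u, 0) := by
  simp [dirDeriv]

theorem dirDeriv_right {E : Type*} [AddCommGroup E] [Module ℝ E] 
    {A : E → E → ℝ} (w p u : E) : dirDeriv (A p) w u
    = dirDeriv (fun q : E × E => A q.1 q.2) (p, w) (0, u) := by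
  simp [dirDeriv]

end IsLocalForm

variable [IsTopologicalAddGroup E] [ContinuousSMul ℝ E]

theorem eventually_line_mem (hU : IsOpen U) {p : E} (hp : p ∈ U) (v : E) :
    ∀ᶠ t : ℝ in 𝓝 0, p + t • v ∈ U :=
  (isSmoothCurve_line p v).continuous.continuousAt.preimage_mem_nhds (hU.mem_nhds (by simpa))

theorem dirDeriv_congr_of_eqOn {F : Type*} [AddCommGroup F] [Module ℝ F] [TopologicalSpace F]
    [T2Space F] {f g : E → F} (hg : IsSmoothOn g U) (hU : IsOpen U) (h : EqOn f g U) {p : E}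
    (hp : p ∈ U) (v : E) : dirDeriv f p v = dirDeriv g p v := by
  refine HasCurveDerivAt.dirDeriv_eq ((hg.hasCurveDerivAt_line hU hp v).congr_of_eventuallyEq ?_)
  filter_upwards [eventually_line_mem hU hp v] with t ht using h ht

theorem dirDeriv_zero_of_forall {g : E → ℝ} (hU : IsOpen U) (h : ∀ p ∈ U, g p = 0) {p : E}
    (hp : p ∈ U) (v : E) : dirDeriv g p v = 0 := by
  rw [dirDeriv_congr_of_eqOn (isSmoothOn_const 0) hU h hp]
  exact HasCurveDerivAt.dirDeriv_eq (hasCurveDerivAt_const _ _)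

theorem IsSmoothOn.dirDeriv_sub_fun {f g : E → ℝ} (hf : IsSmoothOn f U) (hg : IsSmoothOn g U)
    (hU : IsOpen U) {p : E} (hp : p ∈ U) (v : E) :
    dirDeriv (fun p => f p - g p) p v = dirDeriv f p v - dirDeriv g p v := by
  have hf' := hasCurveDerivAt_iff_hasDerivAt.1 (hf.hasCurveDerivAt_line hU hp v)
  have hg' := hasCurveDerivAt_iff_hasDerivAt.1 (hg.hasCurveDerivAt_line hU hp v)
  exact HasCurveDerivAt.dirDeriv_eq (hasCurveDerivAt_iff_hasDerivAt.2 (hf'.sub hg'))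

theorem IsSmoothOn.dirDeriv_add_fun {f g : E → ℝ} (hf : IsSmoothOn f U) (hg : IsSmoothOn g U)
    (hU : IsOpen U) {p : E} (hp : p ∈ U) (v : E) :
    dirDeriv (fun p => f p + g p) p v = dirDeriv f p v + dirDeriv g p v :=
  HasCurveDerivAt.dirDeriv_eq
    ((hf.hasCurveDerivAt_line hU hp v).add (hg.hasCurveDerivAt_line hU hp v))

theorem dirDeriv_comp [LocallyConvexSpace ℝ E] {F : Type*} [AddCommGroup F] [Module ℝ F]
    [TopologicalSpace F] [IsTopologicalAddGroup F] [ContinuousSMul ℝ F] [LocallyConvexSpace ℝ F]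
    [T2Space F] {G : Type*} [AddCommGroup G] [Module ℝ G]
    [TopologicalSpace G] [IsTopologicalAddGroup G] [ContinuousSMul ℝ G] [LocallyConvexSpace ℝ G]
    [T2Space G] {f : E → F} {g : F → G} {V : Set F} (hg : IsSmoothOn g V) (hV : IsOpen V)
    (hf : IsSmoothOn f U) (hU : IsOpen U) (hfUV : MapsTo f U V) {p : E} (hp : p ∈ U) (v : E) :
    dirDeriv (fun p => g (f p)) p v = dirDeriv g (f p) (dirDeriv f p v) := by
  refine HasCurveDerivAt.dirDeriv_eq ?_
  obtain ⟨ε, hε, h1⟩ := Metric.mem_nhds_iff.1 (eventually_line_mem hU hp v)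
  obtain ⟨ρ, hρ, hρ0, hρε⟩ := exists_contDiff_abs_lt hε
  have h2 : ∀ t, p + ρ t • v ∈ U := fun t => h1 (by simpa using hρε t)
  have h3 := hf _ ((isSmoothCurve_line p v).comp hρ) h2
  have h4 : HasCurveDerivAt (fun t => f (p + ρ t • v)) (dirDeriv f p v) 0 := by
    refine (hf.hasCurveDerivAt_line hU hp v).congr_of_eventuallyEq ?_
    filter_upwards [hρ0] with t ht
    rw [ht]
  have h5 : p + ρ 0 • v = p := by rw [hρ0.self_of_nhds, zero_smul, add_zero]
  have h6 := hg.hasCurveDerivAt_comp hV h3 h4 (hfUV (h2 0))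
  rw [h5] at h6
  refine h6.congr_of_eventuallyEq ?_
  filter_upwards [hρ0] with t ht
  rw [ht]

namespace IsLocalForm

variable {A : E → E → ℝ}

theorem dirDeriv_prod (hA : IsLocalForm A U) {p : E} (hp : p ∈ U) (w u v : E) :
    dirDeriv (fun q : E × E => A q.1 q.2) (p, w) (u, v)
      = dirDeriv (fun p => A p w) p u + A p v := by
  have h := hA.smooth.dirDeriv_add_real (hA.isOpen.prod isOpen_univ) (p := (p, w))
    ⟨hp, mem_univ _⟩ (u, 0) (0, v)
  rw [Prod.mk_add_mk, add_zero, zero_add] at h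
  rw [h, ← dirDeriv_left, ← dirDeriv_right, hA.dirDeriv_apply hp]

theorem localExtDeriv_add (hA : IsLocalForm A U) {p : E} (hp : p ∈ U) (u v w : E) :
    localExtDeriv A p (u + v) w = localExtDeriv A p u w + localExtDeriv A p v w := by
  have h1 : dirDeriv (fun p => A p (u + v)) p w
      = dirDeriv (fun p => A p u + A p v) p w :=
    dirDeriv_congr_of_eqOn (isSmoothOn_add (hA.smooth_left u) (hA.smooth_left v)) hA.isOpen
      (fun p hp => hA.add p hp u v) hp w
  rw [localExtDeriv, h1, (hA.smooth_left w).dirDeriv_add_real hA.isOpen hp,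
    (hA.smooth_left u).dirDeriv_add_fun (hA.smooth_left v) hA.isOpen hp, localExtDeriv,
    localExtDeriv]
  ring

theorem localExtDeriv_smul (hA : IsLocalForm A U) {p : E} (hp : p ∈ U) (a : ℝ) (u w : E) :
    localExtDeriv A p (a • u) w = a * localExtDeriv A p u w := by
  have h1 : dirDeriv (fun p => A p (a • u)) p w = dirDeriv (fun p => a * A p u) p w :=
    dirDeriv_congr_of_eqOn (isSmoothOn_const_mul (hA.smooth_left u) a) hA.isOpen
      (fun p hp => hA.smul p hp a u) hp w
  have h2 : dirDeriv (fun p => a * A p u) p w = a * dirDeriv (fun p => A p u) p w := by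
    refine HasCurveDerivAt.dirDeriv_eq (hasCurveDerivAt_iff_hasDerivAt.2 ?_)
    exact (hasCurveDerivAt_iff_hasDerivAt.1
      ((hA.smooth_left u).hasCurveDerivAt_line hA.isOpen hp w)).const_mul a
  rw [localExtDeriv, h1, h2, (hA.smooth_left w).dirDeriv_smul hA.isOpen hp, localExtDeriv,
    smul_eq_mul]
  ring

/-- Contracting the exterior derivative with a constant vector field gives a 1-form. -/
theorem contract (hA : IsLocalForm A U) (w : E) :
    IsLocalForm (fun p u => localExtDeriv A p u w) U where
  isOpen := hA.isOpen
  smooth := by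
    have hd := hA.smooth.dirDeriv_prod (hA.isOpen.prod isOpen_univ)
    have h1 : IsSmoothOn (fun q : E × E => dirDeriv (fun p => A p w) q.1 q.2) (U ×ˢ univ) :=
      (hA.smooth_left w).dirDeriv_prod hA.isOpen
    have h2 : IsSmoothOn (fun q : E × E => dirDeriv (fun p => A p q.2) q.1 w) (U ×ˢ univ) := by
      intro c hc hcU
      -- Here the vector argument of `A` moves with the curve; viewing `A` as a function on `E × E`
      -- turns it into part of the base point.
      simp only [dirDeriv_left]
      exact hd (fun t => (((c t).1, (c t).2), (w, 0)))
        ((hc.fst.prodMk hc.snd).prodMk (isSmoothCurve_const _))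
        fun t => ⟨⟨(hcU t).1, mem_univ _⟩, mem_univ _⟩
    exact isSmoothOn_sub h1 h2
  add p hp u v := hA.localExtDeriv_add hp u v w
  smul p hp a u := hA.localExtDeriv_smul hp a u w

/-- The exterior derivative is closed. -/
theorem dirDeriv_localExtDeriv_cyclic (hA : IsLocalForm A U) {p : E} (hp : p ∈ U) (u v w : E) :
    dirDeriv (fun p => localExtDeriv A p v w) p u - dirDeriv (fun p => localExtDeriv A p u w) p v
      + dirDeriv (fun p => localExtDeriv A p u v) p w = 0 := by
  have h1 : ∀ u v w, dirDeriv (fun p => localExtDeriv A p v w) p u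
      = dirDeriv (fun p => dirDeriv (fun p => A p w) p v) p u
        - dirDeriv (fun p => dirDeriv (fun p => A p v) p w) p u := fun u v w =>
    ((hA.smooth_left w).dirDeriv_right hA.isOpen v).dirDeriv_sub_fun
      ((hA.smooth_left v).dirDeriv_right hA.isOpen w) hA.isOpen hp u
  rw [h1, h1, h1, (hA.smooth_left w).dirDeriv_comm hA.isOpen hp u v,
    (hA.smooth_left v).dirDeriv_comm hA.isOpen hp u w,
    (hA.smooth_left u).dirDeriv_comm hA.isOpen hp v w]
  ring

variable [LocallyConvexSpace ℝ E] [T2Space E]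

theorem dirDeriv_apply_field (hA : IsLocalForm A U) {Y : E → E} (hY : IsSmoothOn Y U) {p : E}
    (hp : p ∈ U) (v : E) : dirDeriv (fun p => A p (Y p)) p v
      = dirDeriv (fun q => A q (Y p)) p v + A p (dirDeriv Y p v) := by
  have h1 : IsSmoothOn (fun p => (p, Y p)) U := isSmoothOn_id.prodMk hY
  have h2 : dirDeriv (fun p => (p, Y p)) p v = (v, dirDeriv Y p v) :=
    HasCurveDerivAt.dirDeriv_eq
      ((hasCurveDerivAt_line p v 0).prodMk (hY.hasCurveDerivAt_line hA.isOpen hp v))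
  rw [dirDeriv_comp hA.smooth (hA.isOpen.prod isOpen_univ) h1 hA.isOpen
    (fun q hq => ⟨hq, mem_univ _⟩) hp, h2, hA.dirDeriv_prod hp]

/-- Naturality of the exterior derivative. -/
theorem localExtDeriv_pullback (hA : IsLocalForm A U) {A' : E → E → ℝ} {U' : Set E}
    (hA' : IsLocalForm A' U') {ψ : E → E} (hψ : IsSmoothOn ψ U) (hm : MapsTo ψ U U')
    (h : ∀ p ∈ U, ∀ u, A p u = A' (ψ p) (dirDeriv ψ p u)) {p : E} (hp : p ∈ U) (u w : E) :
    localExtDeriv A p u w = localExtDeriv A' (ψ p) (dirDeriv ψ p u) (dirDeriv ψ p w) := by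
  -- Since `A' (ψ q)` is linear, `A p u` is the derivative of `θ` at `(p, p)` along `(0, u)`.
  -- Differentiating along the diagonal vector `(w, w) = (w, 0) + (0, w)`, the first part gives the
  -- derivative of `A'`. The second is a second derivative of `θ` along `(0, u)` and `(0, w)`,
  -- symmetric in `u, w`, and cancels in `d`; no second derivative of `ψ` is needed.
  let θ : E × E → ℝ := fun q => A' (ψ q.1) (ψ q.2)
  have hU := hA.isOpen
  have hUU := hU.prod hU
  have hpp : (p, p) ∈ U ×ˢ U := ⟨hp, hp⟩
  have hθ : IsSmoothOn θ (U ×ˢ U) := fun c hc hcU =>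
    hA'.smooth (fun t => (ψ (c t).1, ψ (c t).2))
      ((hψ _ hc.fst fun t => (hcU t).1).prodMk (hψ _ hc.snd fun t => (hcU t).2))
      fun t => ⟨hm (hcU t).1, mem_univ _⟩
  have h1 : ∀ q ∈ U, ∀ z ∈ U, ∀ u, dirDeriv θ (q, z) (0, u) = A' (ψ q) (dirDeriv ψ z u) := by
    intro q hq z hz u
    have h2 : dirDeriv θ (q, z) (0, u) = dirDeriv (fun z => A' (ψ q) (ψ z)) z u := by
      simp [θ, dirDeriv]
    rw [h2, dirDeriv_comp (hA'.smooth_right (hm hq)) isOpen_univ hψ hU (mapsTo_univ _ _) hz,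
      hA'.dirDeriv_apply (hm hq)]
  have hΔ : IsSmoothOn (fun p : E => (p, p)) U := isSmoothOn_id.prodMk isSmoothOn_id
  have key : ∀ u w, dirDeriv (fun p => A p u) p w
      = dirDeriv (fun q => A' q (dirDeriv ψ p u)) (ψ p) (dirDeriv ψ p w)
        + dirDeriv (fun q => dirDeriv θ q (0, u)) (p, p) (0, w) := by
    intro u w
    have h2 : IsSmoothOn (fun q => dirDeriv θ q (0, u)) (U ×ˢ U) := hθ.dirDeriv_right hUU _
    have h3 : dirDeriv (fun p => A p u) p w
        = dirDeriv (fun p => dirDeriv θ (p, p) (0, u)) p w := by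
      refine dirDeriv_congr_of_eqOn (U := U) ?_ hU (fun q hq => ?_) hp w
      · exact h2.comp hΔ fun q hq => ⟨hq, hq⟩
      · rw [h1 q hq q hq, h q hq]
    have h4 : dirDeriv (fun p : E => (p, p)) p w = (w, w) :=
      HasCurveDerivAt.dirDeriv_eq ((hasCurveDerivAt_line p w 0).prodMk (hasCurveDerivAt_line p w 0))
    have h5 := h2.dirDeriv_add_real hUU hpp (w, 0) (0, w)
    rw [Prod.mk_add_mk, add_zero, zero_add] at h5
    have h6 : dirDeriv (fun q => dirDeriv θ q (0, u)) (p, p) (w, 0)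
        = dirDeriv (fun q => dirDeriv θ (q, p) (0, u)) p w := by
      simp [dirDeriv]
    have h7 : dirDeriv (fun q => dirDeriv θ (q, p) (0, u)) p w
        = dirDeriv (fun q => A' (ψ q) (dirDeriv ψ p u)) p w :=
      dirDeriv_congr_of_eqOn ((hA'.smooth_left _).comp hψ hm) hU (fun q hq => h1 q hq p hp u) hp w
    rw [h3, dirDeriv_comp h2 hUU hΔ hU (fun q hq => ⟨hq, hq⟩) hp, h4, h5, h6, h7,
      dirDeriv_comp (hA'.smooth_left _) hA'.isOpen hψ hU hm hp]
  rw [localExtDeriv, key, key, hθ.dirDeriv_comm hUU hpp, localExtDeriv]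
  ring

theorem apply_bracket (hA : IsLocalForm A U) {X Y : E → E} (hX : IsSmoothOn X U)
    (hY : IsSmoothOn Y U) (hAX : ∀ p ∈ U, A p (X p) = 0) (hAY : ∀ p ∈ U, A p (Y p) = 0)
    {p : E} (hp : p ∈ U) (hXY : localExtDeriv A p (X p) (Y p) = 0) :
    A p (dirDeriv Y p (X p) - dirDeriv X p (Y p)) = 0 := by
  have h1 := hA.dirDeriv_apply_field hY hp (X p)
  have h2 := hA.dirDeriv_apply_field hX hp (Y p)
  rw [dirDeriv_zero_of_forall hA.isOpen hAY hp] at h1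
  rw [dirDeriv_zero_of_forall hA.isOpen hAX hp] at h2
  have h3 := hA.add p hp (dirDeriv Y p (X p)) ((-1 : ℝ) • dirDeriv X p (Y p))
  rw [hA.smul p hp, neg_smul, one_smul, ← sub_eq_add_neg] at h3
  rw [localExtDeriv] at hXY
  linarith

/-- Differentiating the vanishing contractions expresses `dA([X, Y], w)` through derivatives of `dA`
with frozen arguments; the cyclic identity reduces these to a derivative along `w`, which vanishes
as well. -/
theorem localExtDeriv_bracket (hA : IsLocalForm A U) {X Y : E → E} (hX : IsSmoothOn X U)
    (hY : IsSmoothOn Y U) (hAX : ∀ p ∈ U, ∀ w, localExtDeriv A p (X p) w = 0)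
    (hAY : ∀ p ∈ U, ∀ w, localExtDeriv A p (Y p) w = 0) {p : E} (hp : p ∈ U) (w : E) :
    localExtDeriv A p (dirDeriv Y p (X p) - dirDeriv X p (Y p)) w = 0 := by
  have h1 := (hA.contract w).dirDeriv_apply_field hY hp (X p)
  have h2 := (hA.contract w).dirDeriv_apply_field hX hp (Y p)
  -- `Y` may be frozen at `p`, as `X` annihilates every constant vector near `p`; the remaining term
  -- `dA(DX·w, Y p)` vanishes because `Y p` is in the kernel.
  have h3 := (hA.contract (Y p)).dirDeriv_apply_field hX hp w
  rw [dirDeriv_zero_of_forall hA.isOpen (fun q hq => hAY q hq w) hp] at h1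
  rw [dirDeriv_zero_of_forall hA.isOpen (fun q hq => hAX q hq w) hp] at h2
  rw [dirDeriv_zero_of_forall hA.isOpen (fun q hq => hAX q hq (Y p)) hp,
    localExtDeriv_swap A p (dirDeriv X p w), hAY p hp] at h3
  have h4 := hA.dirDeriv_localExtDeriv_cyclic hp (X p) (Y p) w
  have h5 := hA.localExtDeriv_add hp (dirDeriv Y p (X p)) ((-1 : ℝ) • dirDeriv X p (Y p)) w
  rw [hA.localExtDeriv_smul hp, neg_smul, one_smul, ← sub_eq_add_neg] at h5
  linarith

end IsLocalForm

end LocalForms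

/-! ### Chart changes and the passage to the manifold -/

section Charts

variable {E : Type*} [AddCommGroup E] [Module ℝ E] [TopologicalSpace E]
  {M : Type*} [TopologicalSpace M] [ChartedSpace E M]

theorem isOpen_transition_domain {E M : Type*} [TopologicalSpace E] [TopologicalSpace M]
    (e e' : OpenPartialHomeomorph M E) :
    IsOpen (e.target ∩ e.symm ⁻¹' e'.source) :=
  e.isOpen_inter_preimage_symm e'.open_source

theorem mem_transition_domain {E M : Type*} [TopologicalSpace E] [TopologicalSpace M]
    {e e' : OpenPartialHomeomorph M E} {x : M} (hx : x ∈ e.source)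
    (hx' : x ∈ e'.source) : e x ∈ e.target ∩ e.symm ⁻¹' e'.source :=
  ⟨e.map_source hx, by simpa [e.left_inv hx] using hx'⟩

theorem fieldInChart_apply {e : OpenPartialHomeomorph M E} (X : ∀ x : M, TangentAt E x) {x : M}
    (hx : x ∈ e.source) : fieldInChart e X (e x) = toChart e x (X x) := by
  rw [fieldInChart, e.left_inv hx]

theorem formInChart_apply {e : OpenPartialHomeomorph M E} (η : ∀ x : M, TangentAt E x →ₗ[ℝ] ℝ)
    {x : M} (hx : x ∈ e.source) (u : E) : formInChart e η (e x) u = η x (ofChart e x u) := by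
  rw [formInChart, e.left_inv hx]

variable [ConvenientSpace E]

theorem dirDeriv_transition_self {M : Type*} [TopologicalSpace M] {e : OpenPartialHomeomorph M E} {x : M}
    (hx : x ∈ e.source) (v : E) : dirDeriv (fun p => e (e.symm p)) (e x) v = v := by
  rw [dirDeriv_congr_of_eqOn isSmoothOn_id e.open_target (fun p hp => e.right_inv hp)
    (e.map_source hx)]
  exact HasCurveDerivAt.dirDeriv_eq (hasCurveDerivAt_line _ _ _)

theorem toChart_chartAt_self (x : M) (v : TangentAt E x) : toChart (chartAt E x) x v = v :=
  dirDeriv_transition_self (mem_chart_source E x) v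

theorem ofChart_chartAt_self (x : M) (u : E) : ofChart (chartAt E x) x u = u :=
  dirDeriv_transition_self (mem_chart_source E x) u

theorem extDeriv_eq_localExtDeriv (η : OneForm E M) (x : M) (v w : TangentAt E x) :
    extDeriv η x v w = localExtDeriv (formInChart (chartAt E x) η.toFun) (chartAt E x x) v w := by
  simp only [extDeriv, toChart_chartAt_self]
  rfl

variable [SmoothManifold E M]

/-- The cocycle rule for tangent vectors: the chain rule on the triple overlap of the charts. -/
theorem dirDeriv_transition_comp {e e' e'' : OpenPartialHomeomorph M E} (he : e ∈ atlas E M)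
    (he' : e' ∈ atlas E M) (he'' : e'' ∈ atlas E M) {x : M} (hx : x ∈ e.source)
    (hx' : x ∈ e'.source) (hx'' : x ∈ e''.source) (v : E) :
    dirDeriv (fun p => e'' (e'.symm p)) (e' x) (dirDeriv (fun p => e' (e.symm p)) (e x) v)
      = dirDeriv (fun p => e'' (e.symm p)) (e x) v := by
  let U : Set E := e.target ∩ e.symm ⁻¹' (e'.source ∩ e''.source)
  have hU : IsOpen U := e.isOpen_inter_preimage_symm (e'.open_source.inter e''.open_source)
  have hxU : e x ∈ U := ⟨e.map_source hx, by simpa [e.left_inv hx] using ⟨hx', hx''⟩⟩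
  have h1 : IsSmoothOn (fun p => e' (e.symm p)) U := fun c hc hcU =>
    SmoothManifold.smooth_transition e he e' he' c hc fun t => ⟨(hcU t).1, (hcU t).2.1⟩
  have h2 : IsSmoothOn (fun p => e'' (e.symm p)) U := fun c hc hcU =>
    SmoothManifold.smooth_transition e he e'' he'' c hc fun t => ⟨(hcU t).1, (hcU t).2.2⟩
  have h3 := dirDeriv_comp (SmoothManifold.smooth_transition e' he' e'' he'')
    (isOpen_transition_domain e' e'') h1 hU
    (fun p hp => mem_transition_domain hp.2.1 hp.2.2) hxU v
  simp only [e.left_inv hx] at h3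
  rw [← h3]
  refine dirDeriv_congr_of_eqOn h2 hU (fun p hp => ?_) hxU v
  simp only [e'.left_inv hp.2.1]

theorem ofChart_toChart {e : OpenPartialHomeomorph M E} (he : e ∈ atlas E M) {x : M}
    (hx : x ∈ e.source) (v : TangentAt E x) : ofChart e x (toChart e x v) = v :=
  (dirDeriv_transition_comp (chart_mem_atlas E x) he (chart_mem_atlas E x)
    (mem_chart_source E x) hx (mem_chart_source E x) v).trans
    (dirDeriv_transition_self (mem_chart_source E x) v)

theorem ofChart_dirDeriv_transition {e e' : OpenPartialHomeomorph M E} (he : e ∈ atlas E M)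
    (he' : e' ∈ atlas E M) {x : M} (hx : x ∈ e.source) (hx' : x ∈ e'.source) (u : E) :
    ofChart e' x (dirDeriv (fun p => e' (e.symm p)) (e x) u) = ofChart e x u :=
  dirDeriv_transition_comp he he' (chart_mem_atlas E x) hx hx' (mem_chart_source E x) u

theorem formInChart_transition {e e' : OpenPartialHomeomorph M E} (he : e ∈ atlas E M)
    (he' : e' ∈ atlas E M) (η : ∀ x : M, TangentAt E x →ₗ[ℝ] ℝ) {x : M} (hx : x ∈ e.source)
    (hx' : x ∈ e'.source) (u : E) :
    formInChart e' η (e' x) (dirDeriv (fun p => e' (e.symm p)) (e x) u)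
      = formInChart e η (e x) u := by
  rw [formInChart_apply η hx', formInChart_apply η hx, ofChart_dirDeriv_transition he he' hx hx']

theorem ofChart_add {e : OpenPartialHomeomorph M E} (he : e ∈ atlas E M) {x : M}
    (hx : x ∈ e.source) (u v : E) : ofChart e x (u + v) = ofChart e x u + ofChart e x v :=
  IsSmoothOn.dirDeriv_add
    (SmoothManifold.smooth_transition e he (chartAt E x) (chart_mem_atlas E x))
    (isOpen_transition_domain _ _) (mem_transition_domain hx (mem_chart_source E x)) u v

theorem ofChart_smul {e : OpenPartialHomeomorph M E} (he : e ∈ atlas E M) {x : M}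
    (hx : x ∈ e.source) (a : ℝ) (u : E) : ofChart e x (a • u) = a • ofChart e x u :=
  IsSmoothOn.dirDeriv_smul
    (SmoothManifold.smooth_transition e he (chartAt E x) (chart_mem_atlas E x))
    (isOpen_transition_domain _ _) (mem_transition_domain hx (mem_chart_source E x)) a u

theorem OneForm.isLocalForm (η : OneForm E M) {e : OpenPartialHomeomorph M E}
    (he : e ∈ atlas E M) : IsLocalForm (formInChart e η.toFun) e.target where
  isOpen := e.open_target
  smooth := η.smooth e he
  add p hp u v := by
    rw [formInChart, ofChart_add he (e.map_target hp), map_add]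
    rfl
  smul p hp a u := by
    rw [formInChart, ofChart_smul he (e.map_target hp), map_smul]
    rfl

/-- `extDeriv η y` is defined in the preferred chart at `y`, whereas the bracket at `x` is computed
in one chart for all nearby `y`; naturality under the chart change reconciles the two. -/
theorem localExtDeriv_formInChart_transition (η : OneForm E M) {e e' : OpenPartialHomeomorph M E}
    (he : e ∈ atlas E M) (he' : e' ∈ atlas E M) {x : M} (hx : x ∈ e.source) (hx' : x ∈ e'.source)
    (u w : E) : localExtDeriv (formInChart e η.toFun) (e x) u w
      = localExtDeriv (formInChart e' η.toFun) (e' x) (dirDeriv (fun p => e' (e.symm p)) (e x) u)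
        (dirDeriv (fun p => e' (e.symm p)) (e x) w) := by
  have h := ((η.isLocalForm he).mono (isOpen_transition_domain e e')
    inter_subset_left).localExtDeriv_pullback (η.isLocalForm he')
    (SmoothManifold.smooth_transition e he e' he') (fun p hp => e'.map_source hp.2)
    (fun p hp v => ?_) (mem_transition_domain hx hx') u w
  · simpa only [e.left_inv hx] using h
  · have h1 := formInChart_transition he he' η.toFun (e.map_target hp.1) hp.2 v
    rw [e.right_inv hp.1] at h1
    exact h1.symm

/-- In any chart, the exterior derivative is given by the usual formula. -/
theorem localExtDeriv_formInChart (η : OneForm E M) {e : OpenPartialHomeomorph M E}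
    (he : e ∈ atlas E M) {x : M} (hx : x ∈ e.source) (u w : E) :
    localExtDeriv (formInChart e η.toFun) (e x) u w
      = extDeriv η x (ofChart e x u) (ofChart e x w) := by
  rw [localExtDeriv_formInChart_transition η he (chart_mem_atlas E x) hx (mem_chart_source E x),
    extDeriv_eq_localExtDeriv]
  rfl

theorem exists_submodule_eq_horizontal_inter_vertical (η : OneForm E M) (x : M) :
    ∃ S : Submodule ℝ (TangentAt E x),
      (S : Set (TangentAt E x)) = horizontal η x ∩ vertical η x := by
  have hA := η.isLocalForm (chart_mem_atlas E x)
  have hp := mem_chart_target E x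
  have hadd : ∀ u v w : TangentAt E x,
      extDeriv η x (u + v) w = extDeriv η x u w + extDeriv η x v w := fun u v w => by
    simp only [extDeriv_eq_localExtDeriv]
    exact hA.localExtDeriv_add hp u v w
  have hsmul : ∀ (a : ℝ) (u w : TangentAt E x), extDeriv η x (a • u) w = a * extDeriv η x u w :=
    fun a u w => by
      simp only [extDeriv_eq_localExtDeriv]
      exact hA.localExtDeriv_smul hp a u w
  have hzero : ∀ w : TangentAt E x, extDeriv η x 0 w = 0 := fun w => by
    simpa using hsmul 0 0 w
  refine ⟨{ carrier := horizontal η x ∩ vertical η x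
            add_mem' := ?_, zero_mem' := ?_, smul_mem' := ?_ }, rfl⟩
  · rintro u v ⟨hu, hu'⟩ ⟨hv, hv'⟩
    refine ⟨?_, fun w => ?_⟩
    · change η.toFun x u = 0 at hu
      change η.toFun x v = 0 at hv
      change η.toFun x (u + v) = 0
      rw [map_add, hu, hv, add_zero]
    · rw [hadd, hu' w, hv' w, add_zero]
  · exact ⟨map_zero _, hzero⟩
  · rintro a u ⟨hu, hu'⟩
    refine ⟨?_, fun w => ?_⟩
    · change η.toFun x u = 0 at hu
      change η.toFun x (a • u) = 0
      rw [map_smul, hu, smul_zero]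
    · rw [hsmul, hu' w, mul_zero]

theorem formInChart_fieldInChart_eq_zero (η : OneForm E M) {e : OpenPartialHomeomorph M E}
    (he : e ∈ atlas E M) {X : ∀ x : M, TangentAt E x} {x : M} (hx : x ∈ e.source)
    (hX : X x ∈ horizontal η x) : formInChart e η.toFun (e x) (fieldInChart e X (e x)) = 0 := by
  rw [formInChart_apply _ hx, fieldInChart_apply X hx, ofChart_toChart he hx]
  exact hX

theorem localExtDeriv_fieldInChart_eq_zero (η : OneForm E M) {e : OpenPartialHomeomorph M E}
    (he : e ∈ atlas E M) {X : ∀ x : M, TangentAt E x} {x : M} (hx : x ∈ e.source)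
    (hX : X x ∈ vertical η x) (w : E) :
    localExtDeriv (formInChart e η.toFun) (e x) (fieldInChart e X (e x)) w = 0 := by
  rw [localExtDeriv_formInChart η he hx, fieldInChart_apply X hx, ofChart_toChart he hx]
  exact hX _

theorem lieBracket_mem_horizontal_inter_vertical (η : OneForm E M) {W : Set M} (hW : IsOpen W)
    {X Y : ∀ x : M, TangentAt E x} (hX : IsSmoothFieldOn X W) (hY : IsSmoothFieldOn Y W)
    (hXm : ∀ x ∈ W, X x ∈ horizontal η x ∩ vertical η x)
    (hYm : ∀ x ∈ W, Y x ∈ horizontal η x ∩ vertical η x) {x : M} (hx : x ∈ W) :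
    lieBracket X Y x ∈ horizontal η x ∩ vertical η x := by
  let e := chartAt E x
  have he : e ∈ atlas E M := chart_mem_atlas E x
  have hxe : x ∈ e.source := mem_chart_source E x
  have hA := (η.isLocalForm he).mono (e.isOpen_inter_preimage_symm hW) inter_subset_left
  have hp : e x ∈ e.target ∩ e.symm ⁻¹' W :=
    ⟨e.map_source hxe, by simpa [e.left_inv hxe] using hx⟩
  have hH : ∀ Z : ∀ x : M, TangentAt E x, (∀ x ∈ W, Z x ∈ horizontal η x ∩ vertical η x) →
      ∀ p ∈ e.target ∩ e.symm ⁻¹' W, formInChart e η.toFun p (fieldInChart e Z p) = 0 := by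
    intro Z hZ p hp
    have := formInChart_fieldInChart_eq_zero η he (e.map_target hp.1) (hZ _ hp.2).1
    rwa [e.right_inv hp.1] at this
  have hV : ∀ Z : ∀ x : M, TangentAt E x, (∀ x ∈ W, Z x ∈ horizontal η x ∩ vertical η x) →
      ∀ p ∈ e.target ∩ e.symm ⁻¹' W, ∀ w,
        localExtDeriv (formInChart e η.toFun) p (fieldInChart e Z p) w = 0 := by
    intro Z hZ p hp w
    have := localExtDeriv_fieldInChart_eq_zero η he (e.map_target hp.1) (hZ _ hp.2).2 w
    rwa [e.right_inv hp.1] at this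
  refine ⟨?_, fun (w : E) => ?_⟩
  -- The bracket in the chart, carried back by `ofChart`, is `lieBracket X Y x` by definition.
  · have h := hA.apply_bracket (hX e he) (hY e he) (hH X hXm) (hH Y hYm) hp (hV X hXm _ hp _)
    rwa [formInChart_apply _ hxe] at h
  · have h := hA.localExtDeriv_bracket (hX e he) (hY e he) (hV X hXm) (hV Y hYm) hp w
    rwa [localExtDeriv_formInChart η he hxe, ofChart_chartAt_self x w] at h

end Charts

end Convenient

theorem mainTheorem12 {E : Type*} [AddCommGroup E] [Module ℝ E] [TopologicalSpace E]
    [Convenient.ConvenientSpace E] {M : Type*} [TopologicalSpace M] [ChartedSpace E M]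
    [Convenient.SmoothManifold E M] (η : Convenient.OneForm E M) :
    Convenient.IsInvolutiveDistribution
      (fun x : M => Convenient.horizontal η x ∩ Convenient.vertical η x) where
  subspace x := Convenient.exists_submodule_eq_horizontal_inter_vertical η x
  lieBracket_mem _ hW _ _ hX hY hXm hYm _ hx :=
    Convenient.lieBracket_mem_horizontal_inter_vertical η hW hX hY hXm hYm hx
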